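/- Matroids may be infinite; $\mathrm{cl}$ denotes closure and $E(M)$ the ground set. For elements $y,x,z,o,q,r,s$ of a matroid $M$, write $\mathrm{HP}(y,x,z;o,q,r,s)$ if they are distinct and the restriction of $M$ to $\{y,x,z,o,q,r,s\}$ is either the non-Fano matroid $F_7^-$, i.e. the simple matroid of rank $3$ whose three-point lines are exactly $\{y,x,z\},\{y,o,q\},\{y,r,s\},\{x,q,s\},\{z,q,r\},\{z,o,s\}$, or the Fano matroid $F_7$, i.e. the simple matroid of rank $3$ whose three-point lines are exactly these six and $\{x,o,r\}$. Write $\mathrm H(y,z;x,x')$, and call $x'$ a harmonic conjugate of $x$ with respect to $y$ and $z$, if there are elements $o,q,r,s$ with $\mathrm{HP}(y,x,z;o,q,r,s)$ and $\mathrm{cl}(\{y,z\})\cap\mathrm{cl}(\{o,r\})=\{x'\}$. The matroid $M$ is harmonic if, whenever $\mathrm{HP}(y,x,z;o,q,r,s)$ holds in $M$, the set $\mathrm{cl}(\{y,z\})\cap\mathrm{cl}(\{o,r\})$ consists of exactly one element $x'$, and $x'$ depends only on $x,y,z$, not on the choice of $o,q,r,s$. For $S\subseteq E(M)$ put $h(S)=S\cup\{x\in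 E(M): \mathrm H(a,c;b,x)\text{ for some }a,b,c\in S\}$; the harmonic closure of $S$ is $h^\infty(S)=\bigcup_{k\ge 0}h^k(S)$. A conjugate sequence is an infinite sequence $d,b_0,b_1,b_2,\dots$ of elements of $M$ with $\mathrm H(d,b_i;b_{i-1},b_{i+1})$ for all $i\ge 1$. It is modular if some term equals a preceding term; if $b_n$ is the first term equal to one of its preceding terms $d,b_0,\dots,b_{n-1}$, the modular sequence is denoted $d,b_0,\dots,b_{n-1}$. **Proposition.** Let $d,b_0,\dots,b_{n-1}$ be a modular sequence in a harmonic matroid $M$. Then $n$ is a prime number, and there are elements $c_1,c_0,a_1,a_0$ of $M$ such that $P=h^\infty(\{d,b_0,b_1,c_1,c_0,a_1,a_0\})$ is a projective plane of order $n$; that is, the elements of $P$, as points, and the rank-$2$ flats of the restriction $M|P$, as lines, form a projective plane of order $n$. -/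

import Mathlib

namespace HarmonicMatroid

variable {α : Type*}

/-- The six three-point lines of the non-Fano matroid `F₇⁻`, on the labels
`0 = y`, `1 = x`, `2 = z`, `3 = o`, `4 = q`, `5 = r`, `6 = s`:
`yxz`, `yoq`, `yrs`, `xqs`, `zqr`, `zos`. -/
def nonFanoLines : Finset (Finset (Fin 7)) :=
  {{0, 1, 2}, {0, 3, 4}, {0, 5, 6}, {1, 4, 6}, {2, 4, 5}, {2, 3, 6}}

/-- The seven lines of the Fano matroid `F₇`: those of `F₇⁻` and `xor`. -/
def fanoLines : Finset (Finset (Fin 7)) :=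
  insert {1, 3, 5} nonFanoLines

/-- The labelled family `v` consists of seven distinct elements and the restriction of `M` to them
is, along the labelling, the simple matroid of rank 3 whose three-point lines are `lines` (its
independent sets are the sets with at most three elements that are not in `lines`). -/
def RestrictsTo (M : Matroid α) (v : Fin 7 → α) (lines : Finset (Finset (Fin 7))) : Prop :=
  Function.Injective v ∧ (∀ i, v i ∈ M.E) ∧
    ∀ I : Finset (Fin 7), M.Indep (v '' (I : Set (Fin 7))) ↔ I.card ≤ 3 ∧ I ∉ lines

/-- `HP(y, x, z; o, q, r, s)`: the restriction of `M` to `{y, x, z, o, q, r, s}` is the labelled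
Fano or the labelled non-Fano matroid. -/
def HP (M : Matroid α) (y x z o q r s : α) : Prop :=
  RestrictsTo M ![y, x, z, o, q, r, s] fanoLines ∨
    RestrictsTo M ![y, x, z, o, q, r, s] nonFanoLines

/-- `H(y, z; x, x')`: `x'` is a harmonic conjugate of `x` with respect to `y` and `z`. -/
def HarmonicConj (M : Matroid α) (y z x x' : α) : Prop :=
  ∃ o q r s : α, HP M y x z o q r s ∧ M.closure {y, z} ∩ M.closure {o, r} = {x'}

/-- A harmonic matroid: every configuration `HP(y, x, z; o, q, r, s)` gives rise to a harmonic
conjugate of `x` with respect to `y` and `z`, and this depends only on `x`, `y`, `z`. -/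
structure IsHarmonic (M : Matroid α) : Prop where
  exists_conj : ∀ y x z o q r s : α, HP M y x z o q r s →
    ∃ x' : α, M.closure {y, z} ∩ M.closure {o, r} = {x'}
  conj_unique : ∀ y z x x' x'' : α,
    HarmonicConj M y z x x' → HarmonicConj M y z x x'' → x' = x''

/-- The operator `h`: adjoin to `S` all harmonic conjugates of members of `S`. -/
def harmonicStep (M : Matroid α) (S : Set α) : Set α :=
  S ∪ {x | x ∈ M.E ∧ ∃ a ∈ S, ∃ b ∈ S, ∃ c ∈ S, HarmonicConj M a c b x}

/-- The harmonic closure: the union of all iterates `hⁿ(S)`. -/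
def harmonicClosure (M : Matroid α) (S : Set α) : Set α :=
  ⋃ k : ℕ, (harmonicStep M)^[k] S

/-- `d, b₀, b₁, b₂, …` is a conjugate sequence: `H(d, bᵢ; bᵢ₋₁, bᵢ₊₁)` for all `i ≥ 1`. -/
def IsConjugateSequence (M : Matroid α) (d : α) (b : ℕ → α) : Prop :=
  ∀ i : ℕ, HarmonicConj M d (b (i + 1)) (b i) (b (i + 2))

/-- `d, b₀, …, bₙ₋₁` is a modular sequence: in the conjugate sequence `d, b₀, b₁, …` the first
point that is equal to one of its preceding points is `bₙ`. -/
def IsModularSequence (M : Matroid α) (d : α) (b : ℕ → α) (n : ℕ) : Prop :=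
  IsConjugateSequence M d b ∧ IsLeast {m : ℕ | b m = d ∨ ∃ k < m, b m = b k} n

/-- The lines of the restriction of `M` to `X`, that is, its flats of rank 2. -/
def Line (M : Matroid α) (X : Set α) : Type _ :=
  {F : Set α // (M.restrict X).IsFlat F ∧ (M.restrict X).eRk F = 2}

instance (M : Matroid α) (X : Set α) : Membership X (Line M X) :=
  ⟨fun F p => (p : α) ∈ F.1⟩

/-- The elements of `X` and the lines of the restriction of `M` to `X` are the points and the lines
of a projective plane of order `n`. -/
def IsProjectivePlaneOfOrder (M : Matroid α) (X : Set α) (n : ℕ) : Prop :=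
  X ⊆ M.E ∧ ∃ _ : Configuration.ProjectivePlane X (Line M X),
    Configuration.ProjectivePlane.order X (Line M X) = n

end HarmonicMatroid

/-! The matroid enters only through collinearity on a set without parallel elements. There an `HP`
configuration is a quadrangle with its diagonal points (`HP.quad`, `Quad.hp`); Fano or non-Fano
merely records whether `x, o, r` are collinear. Each quadrangle puts the harmonic conjugate on the
line `o r`. By uniqueness, quadrangles with the same `y, x, z` give the same point, and this forces
new incidences.

The configuration behind `H(d, b₁; b₀, b₂)` provides three lines through `d`, carrying the `b_i`,
starting points `a₀, a₁` and starting points `c₀, c₁`. Conjugation extends the last two pairs to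
sequences, and `Start.rule` spreads the initial incidences until `a_i, c_j, b_{i+j}` are collinear
for all `i, j`. The first repetition among the `b_i` is then a return to `b₀`, so all three
sequences are indexed by `ZMod n` (`Start.exists_zmod_grid`).

In such a grid `A, B, C` the conjugate of `A i` with respect to `B (i + j)` and `C j` depends only
on `i + 2j`. These conjugates form a column `A'`, and `B, A', C` is again a grid with the same `d`
(`Grid.exists_next`). Iterating gives columns `H x` with `C m, H 0 k, H x (m x + k)` collinear: `C
m` is the point at infinity of slope `m`.

If `v u = 0` with `v ≠ 0`, the lines of slopes `0` and `v` through `H 0 k` both contain `H u k`, so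
the columns `H u` and `H 0` coincide; but a common point of these columns forces `u = 0`. Hence
`ZMod n` has no zero divisors and `n` is prime. Over this field the points `d, C m, H x y` form a
plane with `n² + n + 1` points. It is closed under conjugation, because suitable quadrangles can be
chosen inside it, and all of it is reached by conjugation from the seven starting points. -/

namespace HarmonicMatroid

/-! ### Quadrangles, linear spaces and harmonic conjugation -/

/-- Four points `y, z, q, s` in general position with the diagonal points
`x = yz ∩ qs`, `o = yq ∩ zs`, `r = ys ∩ zq`, with respect to a collinearity relation. -/
structure Quad {P : Type*} (col : P → P → P → Prop) (y x z o q r s : P) : Prop where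
  yzq : ¬ col y z q
  yzs : ¬ col y z s
  yqs : ¬ col y q s
  zqs : ¬ col z q s
  yzx : col y z x
  qsx : col q s x
  yqo : col y q o
  zso : col z s o
  ysr : col y s r
  zqr : col z q r

/-- A linear space, given by its collinearity relation. -/
structure LinearSpace {P : Type*} (col : P → P → P → Prop) : Prop where
  swap : ∀ {x y z}, col x y z → col y x z
  rot : ∀ {x y z}, col x y z → col y z x
  self : ∀ x y, col x x y
  trans : ∀ {x y u v w}, x ≠ y → col x y u → col x y v → col x y w → col u v w

/-- A linear space with a harmonic conjugation. -/
structure HarmonicSpace {P : Type*} (col : P → P → P → Prop) (conj : P → P → P → P → Prop) : Prop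
    extends LinearSpace col where
  exists_conj : ∀ {y x z o q r s}, Quad col y x z o q r s →
    ∃ x', conj y z x x' ∧ col y z x' ∧ col o r x' ∧ ∀ w, col y z w → col o r w → w = x'
  conj_unique : ∀ {y z x x' x''}, conj y z x x' → conj y z x x'' → x' = x''

namespace LinearSpace

variable {P : Type*} {col : P → P → P → Prop}

theorem right (S : LinearSpace col) (x y : P) : col x y y := S.rot (S.rot (S.self y x))

theorem left (S : LinearSpace col) (x y : P) : col x y x := S.rot (S.self x y)

theorem swap₂ (S : LinearSpace col) {x y z : P} (h : col x y z) : col x z y :=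
  S.swap (S.rot (S.rot h))

theorem ne₁ (S : LinearSpace col) {x y z : P} (h : ¬ col x y z) : x ≠ y := by
  rintro rfl; exact h (S.self _ _)

theorem ne₂ (S : LinearSpace col) {x y z : P} (h : ¬ col x y z) : y ≠ z := by
  rintro rfl; exact h (S.right _ _)

theorem ne₃ (S : LinearSpace col) {x y z : P} (h : ¬ col x y z) : x ≠ z := by
  rintro rfl; exact h (S.left _ _)

/-- Two lines with two distinct common points coincide. -/
theorem line_eq (S : LinearSpace col) {a b p q : P} (hab : a ≠ b) (hpq : p ≠ q)
    (hp : col a b p) (hq : col a b q) (u : P) : col p q u ↔ col a b u :=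
  ⟨fun h => S.trans hpq (S.trans hab hp hq (S.left _ _)) (S.trans hab hp hq (S.right _ _)) h,
    fun h => S.trans hab hp hq h⟩

/-- Supplies `grind only` with all reorderings of a collinear triple. -/
theorem perm (S : LinearSpace col) (x y z : P) (h : col x y z) :
    col y x z ∧ col x z y ∧ col z y x ∧ col y z x ∧ col z x y :=
  ⟨S.swap h, S.swap₂ h, S.swap (S.rot h), S.rot h, S.rot (S.rot h)⟩

/-- Two lines with two distinct common points coincide. -/
theorem collapse (S : LinearSpace col) {a b c e u v : P} (huv : u ≠ v) (hab : a ≠ b)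
    (hce : c ≠ e) (hu : col a b u) (hv : col a b v) (hu' : col c e u) (hv' : col c e v) :
    col a b c :=
  (S.line_eq hab huv hu hv c).1 ((S.line_eq hce huv hu' hv' c).2 (S.left _ _))

/-- Two distinct lines meet in at most one point. -/
theorem meet (S : LinearSpace col) {a b c e u v : P} (h : ¬ col a b c) (hce : c ≠ e)
    (hu : col a b u) (hv : col a b v) (hu' : col c e u) (hv' : col c e v) : u = v := by
  by_contra huv
  exact h (S.collapse huv (S.ne₁ h) hce hu hv hu' hv')

theorem not_col_of_ne (S : LinearSpace col) {d x y z : P} (hxy : x ≠ y) (h : col d x y)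
    (hz : ¬ col d x z) : ¬ col x y z := fun k =>
  hz (S.trans hxy (S.rot h) (S.left _ _) k)

end LinearSpace
end HarmonicMatroid

/-! ### Propagation of incidences on three concurrent lines -/

namespace HarmonicMatroid
namespace HarmonicSpace

variable {P : Type*} {col : P → P → P → Prop} {conj : P → P → P → P → Prop}

/-- Points `a, a'`, `b, b'`, `c, c'` on three lines through `d`. -/
theorem quad_of_lines (S : HarmonicSpace col conj) {d a a' b b' c c' : P}
    (hab : ¬ col d a b) (hbc : ¬ col d b' c) (hac : ¬ col d a c) (hab' : ¬ col d a b')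
    (hb : b ≠ b') (haa : col d a a') (hbb : col d b b') (hcc : col d c c')
    (h : col a c b) (h' : col a c' b') (h'' : col a' c b') : Quad col d b b' c' c a' a := by
  have hp := S.perm
  have hs := S.self
  -- Otherwise the line `a c` would meet the line `d b` in both `b` and `b'`.
  have key : ¬ col b' c a := fun k =>
    hb (S.meet (fun k => hac (S.rot (S.rot k))) (S.ne₃ hab) h (S.rot (S.rot (S.swap k)))
      (S.right _ _) hbb)
  constructor <;> grind only

/-- The hypotheses on the points `d, b₀, b₁, …` and a line `d a₀` and a line `d c₀` through `d`. -/
structure Start (col : P → P → P → Prop) (conj : P → P → P → P → Prop) (d : P) (b : ℕ → P)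
    (a₀ a₁ c₀ c₁ : P) : Prop where
  dab : ∀ i, ¬ col d a₀ (b i)
  dcb : ∀ i, ¬ col d c₀ (b i)
  dac : ¬ col d a₀ c₀
  bb : ∀ i j, col d (b i) (b j)
  b_ne : ∀ i, b i ≠ b (i + 1)
  da : col d a₀ a₁
  dc : col d c₀ c₁
  a_ne : d ≠ a₁
  c_ne : d ≠ c₁
  h₀₀ : col a₀ c₀ (b 0)
  h₀₁ : col a₀ c₁ (b 1)
  h₁₀ : col a₁ c₀ (b 1)
  conj_b : ∀ i, conj d (b (i + 1)) (b i) (b (i + 2))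

namespace Start

variable {d : P} {b : ℕ → P} {a₀ a₁ c₀ c₁ : P}

theorem symm (S : HarmonicSpace col conj) (T : Start col conj d b a₀ a₁ c₀ c₁) :
    Start col conj d b c₀ c₁ a₀ a₁ where
  dab := T.dcb
  dcb := T.dab
  dac := fun k => T.dac (S.swap₂ k)
  bb := T.bb
  b_ne := T.b_ne
  da := T.dc
  dc := T.da
  a_ne := T.c_ne
  c_ne := T.a_ne
  h₀₀ := S.swap T.h₀₀
  h₀₁ := S.swap T.h₁₀
  h₁₀ := S.swap T.h₀₁
  conj_b := T.conj_b

/-- Points of the line `d a₀`, apart from `d`, are not on the other lines. -/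
theorem not_col (S : HarmonicSpace col conj) {a x : P} (h : ¬ col d a₀ x) (ha : d ≠ a)
    (hda : col d a₀ a) : ¬ col d a x := fun k =>
  h ((S.line_eq (S.ne₁ h) ha (S.left _ _) hda x).1 k)

/-- The incidences `(i, j)`, `(i, j + 1)`, `(i + 1, j)` force the incidence `(i + 1, j + 1)`. -/
theorem rule (S : HarmonicSpace col conj) (T : Start col conj d b a₀ a₁ c₀ c₁) {k : ℕ}
    {a a' c c' : P} (ha : d ≠ a) (hc : d ≠ c) (hda : col d a₀ a) (hda' : col d a₀ a')
    (hdc : col d c₀ c) (hdc' : col d c₀ c')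
    (h : col a c (b k)) (h' : col a c' (b (k + 1))) (h'' : col a' c (b (k + 1))) :
    col a' c' (b (k + 2)) := by
  have hp := S.perm
  have hab := fun i => not_col S (T.dab i) ha hda
  have hac : ¬ col d a c := fun k =>
    not_col S T.dac ha hda
      (S.swap₂ ((S.line_eq (S.ne₁ (T.dcb 0)) hc (S.left _ _) hdc a).1 (S.swap₂ k)))
  have hcb := fun i => not_col S (T.dcb i) hc hdc
  obtain ⟨x, hx, -, hx', -⟩ := S.exists_conj (S.quad_of_lines (hab k)
    (fun k => hcb _ (S.swap₂ k)) hac (hab (k + 1)) (T.b_ne k)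
    (S.trans (S.ne₁ T.dac) (S.left _ _) hda hda') (T.bb _ _)
    (S.trans (S.ne₁ (T.dcb 0)) (S.left _ _) hdc hdc') h h' h'')
  -- The quadrangle puts the conjugate of `b k` on the line `c' a'`; uniqueness identifies it with
  -- `b (k + 2)`.
  rw [S.conj_unique hx (T.conj_b k)] at hx'
  exact S.swap hx'

/-- The point `a_i`: the point of the line `d a₀` that is collinear with `c₀, b_i` and
with `c₁, b_{i+1}`. -/
structure IsA (col : P → P → P → Prop) (d : P) (b : ℕ → P) (a₀ c₀ c₁ : P) (i : ℕ) (p : P) :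
    Prop where
  da : col d a₀ p
  h₀ : col p c₀ (b i)
  h₁ : col p c₁ (b (i + 1))

theorem IsA.ne (T : Start col conj d b a₀ a₁ c₀ c₁) {i : ℕ} {p : P}
    (hp : IsA col d b a₀ c₀ c₁ i p) : d ≠ p := by
  rintro rfl
  exact T.dcb i hp.h₀

theorem IsA.unique (S : HarmonicSpace col conj) (T : Start col conj d b a₀ a₁ c₀ c₁) {i : ℕ}
    {p q : P} (hp : IsA col d b a₀ c₀ c₁ i p) (hq : IsA col d b a₀ c₀ c₁ i q) : p = q :=
  S.meet T.dac (S.ne₂ (T.dcb i)) hp.da hq.da (S.rot hp.h₀) (S.rot hq.h₀)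

theorem isA_zero (S : HarmonicSpace col conj) (T : Start col conj d b a₀ a₁ c₀ c₁) :
    IsA col d b a₀ c₀ c₁ 0 a₀ := ⟨S.right _ _, T.h₀₀, T.h₀₁⟩

theorem isA_one (S : HarmonicSpace col conj) (T : Start col conj d b a₀ a₁ c₀ c₁) :
    IsA col d b a₀ c₀ c₁ 1 a₁ :=
  ⟨T.da, T.h₁₀, T.rule S (S.ne₁ T.dac) (S.ne₁ (T.dcb 0)) (S.right _ _) T.da (S.right _ _) T.dc
    T.h₀₀ T.h₀₁ T.h₁₀⟩

/-- The conjugate of `p = a_i` with respect to `d` and `q = a_{i+1}` is computed in the quadrangle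
through `c₁` and `b (i + 1)`, whose diagonal points `c₀, b (i + 2)` put it on the line that defines
`a_{i+2}`. The second incidence of `IsA` follows from `rule`. -/
theorem exists_next (S : HarmonicSpace col conj) (T : Start col conj d b a₀ a₁ c₀ c₁) {i : ℕ}
    {p q : P} (hp : IsA col d b a₀ c₀ c₁ i p) (hq : IsA col d b a₀ c₀ c₁ (i + 1) q) :
    ∃ x, conj d q p x ∧ IsA col d b a₀ c₀ c₁ (i + 2) x := by
  have hP := S.perm
  have hs := S.self
  have hd₁ := S.ne₁ T.dac
  have hd₂ := S.ne₁ (T.dcb 0)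
  have hqb := not_col S (T.dab (i + 1)) (hq.ne T) hq.da
  have hcb := not_col S (T.dcb (i + 1)) T.c_ne T.dc
  have hqc : ¬ col d q c₁ := fun k => not_col S T.dac (hq.ne T) hq.da
    (S.swap₂ ((S.line_eq hd₂ T.c_ne (S.left _ _) T.dc q).1 (S.swap₂ k)))
  have key : ¬ col q c₁ (b (i + 1)) := fun k =>
    T.b_ne (i + 1) (S.meet (fun k => hqc (S.rot (S.rot k))) (S.ne₃ hqb) k hq.h₁
      (S.right _ _) (T.bb _ _))
  have Q : Quad col d p q c₀ c₁ (b (i + 2)) (b (i + 1)) := by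
    have h₁ := hp.h₁
    have h₂ := hq.h₁
    have h₃ := hq.h₀
    have h₄ := T.dc
    have h₅ := T.bb (i + 1) (i + 2)
    have h₆ : col d q p := S.trans hd₁ (S.left _ _) hq.da hp.da
    constructor <;> grind only
  obtain ⟨x, hx, hx₁, hx₂, -⟩ := S.exists_conj Q
  have hx₃ : col d a₀ x := (S.line_eq hd₁ (hq.ne T) (S.left _ _) hq.da x).1 hx₁
  exact ⟨x, hx, hx₃, S.rot (S.rot hx₂), T.rule S (hq.ne T) hd₂ hq.da hx₃ (S.right _ _) T.dc
    hq.h₀ hq.h₁ (S.rot (S.rot hx₂))⟩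

theorem exists_seq (S : HarmonicSpace col conj) (T : Start col conj d b a₀ a₁ c₀ c₁) :
    ∃ a : ℕ → P, a 0 = a₀ ∧ a 1 = a₁ ∧ (∀ i, IsA col d b a₀ c₀ c₁ i (a i)) ∧
      ∀ i, conj d (a (i + 1)) (a i) (a (i + 2)) := by
  have h : ∀ i, (∃ p, IsA col d b a₀ c₀ c₁ i p) ∧ ∃ p, IsA col d b a₀ c₀ c₁ (i + 1) p := by
    intro i
    induction i with
    | zero => exact ⟨⟨_, T.isA_zero S⟩, _, T.isA_one S⟩
    | succ i ih =>
      obtain ⟨⟨p, hp⟩, q, hq⟩ := ih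
      obtain ⟨x, -, hx⟩ := T.exists_next S hp hq
      exact ⟨⟨q, hq⟩, x, hx⟩
  choose a ha using fun i => (h i).1
  refine ⟨a, (ha 0).unique S T (T.isA_zero S), (ha 1).unique S T (T.isA_one S), ha, fun i => ?_⟩
  obtain ⟨x, hx, hx'⟩ := T.exists_next S (ha i) (ha (i + 1))
  rwa [(ha (i + 2)).unique S T hx']

/-- The incidences with `i = 0` or `j = 0` are part of `IsA`, for this start and for its mirror
image `symm`. A double induction with `rule` fills in the rest. -/
theorem exists_grid (S : HarmonicSpace col conj) (T : Start col conj d b a₀ a₁ c₀ c₁) :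
    ∃ a c : ℕ → P, a 0 = a₀ ∧ a 1 = a₁ ∧ c 0 = c₀ ∧ c 1 = c₁ ∧
      (∀ i, d ≠ a i ∧ col d a₀ (a i)) ∧ (∀ i, d ≠ c i ∧ col d c₀ (c i)) ∧
      (∀ i, conj d (a (i + 1)) (a i) (a (i + 2))) ∧
      (∀ i, conj d (c (i + 1)) (c i) (c (i + 2))) ∧ ∀ i j, col (a i) (c j) (b (i + j)) := by
  obtain ⟨a, a0, a1, ha, ha'⟩ := T.exists_seq S
  obtain ⟨c, c0, c1, hc, hc'⟩ := (T.symm S).exists_seq S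
  have hA := fun i => (ha i).ne T
  have hC := fun i => (hc i).ne (T.symm S)
  refine ⟨a, c, a0, a1, c0, c1, fun i => ⟨hA i, (ha i).da⟩, fun i => ⟨hC i, (hc i).da⟩, ha', hc',
    fun i => ?_⟩
  induction i with
  | zero => intro j; rw [a0, zero_add]; exact S.swap (hc j).h₀
  | succ i ih =>
    intro j
    induction j with
    | zero => rw [c0]; exact (ha _).h₀
    | succ j jh =>
      have := T.rule S (hA i) (hC j) (ha i).da (ha (i + 1)).da (hc j).da (hc (j + 1)).da
        (ih j) (ih (j + 1)) (by rwa [add_right_comm] at jh)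
      rwa [show i + 1 + (j + 1) = i + j + 2 by omega]

end Start

/-! ### Cyclic grids and the next column -/

/-- Three concurrent lines with point sequences `A, B, C` indexed by `ZMod n` such that
`A i, B (i + j), C j` are collinear. -/
structure Grid (col : P → P → P → Prop) (n : ℕ) (d : P) (A B C : ZMod n → P) : Prop where
  dA : ∀ i j, col d (A i) (A j)
  dB : ∀ i j, col d (B i) (B j)
  dC : ∀ i j, col d (C i) (C j)
  dAB : ∀ i j, ¬ col d (A i) (B j)
  dAC : ∀ i j, ¬ col d (A i) (C j)
  dBC : ∀ i j, ¬ col d (B i) (C j)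
  injA : A.Injective
  injB : B.Injective
  injC : C.Injective
  abc : ∀ i j, col (A i) (B (i + j)) (C j)

theorem exists_zmod_lift {n : ℕ} [NeZero n] {f : ℕ → P} (h : ∀ m, f (m + n) = f m) :
    ∃ F : ZMod n → P, ∀ m : ℕ, F m = f m :=
  ⟨fun i => f i.val, fun m => by
    simp only [ZMod.val_natCast]; exact Function.Periodic.map_mod_nat h m⟩

theorem Start.exists_zmod_grid (S : HarmonicSpace col conj) {d : P} {b : ℕ → P} {a₀ a₁ c₀ c₁ : P}
    (T : Start col conj d b a₀ a₁ c₀ c₁) {n : ℕ}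
    (hn : IsLeast {m : ℕ | b m = d ∨ ∃ k < m, b m = b k} n) :
    2 ≤ n ∧ ∃ A B C : ZMod n → P, Grid col n d A B C ∧
      A 0 = a₀ ∧ A 1 = a₁ ∧ B 0 = b 0 ∧ B 1 = b 1 ∧ C 0 = c₀ ∧ C 1 = c₁ ∧
      (∀ i, conj d (A (i + 1)) (A i) (A (i + 2))) ∧ (∀ i, conj d (B (i + 1)) (B i) (B (i + 2))) ∧
      ∀ i, conj d (C (i + 1)) (C i) (C (i + 2)) := by
  have hP := S.perm
  have hd : ∀ i, d ≠ b i := fun i => S.ne₃ (T.dab i)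
  obtain ⟨a, c, ha0, ha1, hc0, hc1, ha, hc, hac, hcc, h⟩ := T.exists_grid S
  have dab : ∀ i j, ¬ col d (a i) (b j) := fun i j => Start.not_col S (T.dab j) (ha i).1 (ha i).2
  have dcb : ∀ i j, ¬ col d (c i) (b j) := fun i j => Start.not_col S (T.dcb j) (hc i).1 (hc i).2
  have dac : ∀ i j, ¬ col d (a i) (c j) := fun i j k =>
    Start.not_col S T.dac (ha i).1 (ha i).2 (S.swap₂ ((S.line_eq (S.ne₁ (T.dcb 0)) (hc j).1
      (S.left _ _) (hc j).2 (a i)).1 (S.swap₂ k)))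
  have c_eq : ∀ i j j', b (i + j) = b (i + j') → c j = c j' := fun i j j' e => by
    have h₁ := h i j
    have h₂ := h i j'
    have h₃ := dac i 0
    rw [e] at h₁
    refine S.meet (a := d) (b := c 0) (c := a i) (fun k => h₃ (S.swap₂ k)) (S.ne₂ (dab i (i + j'))) ?_ ?_
      (S.swap₂ h₁) (S.swap₂ h₂)
    · rw [hc0]; exact (hc j).2
    · rw [hc0]; exact (hc j').2
  have a_eq : ∀ i i' j, b (i + j) = b (i' + j) → a i = a i' := fun i i' j e => by
    have h₁ := h i j
    have h₂ := h i' j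
    rw [e] at h₁
    refine S.meet (a := d) (b := a 0) (c := c j) (dac 0 j) (S.ne₂ (dcb j (i' + j))) ?_ ?_
      (S.rot h₁) (S.rot h₂)
    · rw [ha0]; exact (ha i).2
    · rw [ha0]; exact (ha i').2
  have b_eq : ∀ i i' j j', a i = a i' → c j = c j' → b (i + j) = b (i' + j') :=
      fun i i' j j' e e' => by
    have h₂ := h i' j'
    rw [← e, ← e'] at h₂
    exact S.meet (fun k => dac i j (S.rot (S.rot k))) (hd 0) (h i j) h₂ (T.bb _ _) (T.bb _ _)
  have b_inj : ∀ i j, i < n → j < n → b i = b j → i = j := fun i j hi hj e => by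
    rcases lt_trichotomy i j with hij | hij | hij
    · exact absurd (hn.2 (Or.inr ⟨i, hij, e.symm⟩)) (by omega)
    · exact hij
    · exact absurd (hn.2 (Or.inr ⟨j, hij, e⟩)) (by omega)
  obtain ⟨k, hk, hbk⟩ := hn.1.resolve_left (hd n).symm
  obtain rfl : k = 0 := by
    by_contra hk0
    obtain ⟨k, rfl⟩ := Nat.exists_eq_succ_of_ne_zero hk0
    obtain ⟨m, rfl⟩ := Nat.exists_eq_succ_of_ne_zero (show n ≠ 0 by omega)
    -- A repetition `b (1 + m) = b (1 + k)`, projected from `a 1`, gives `c m = c k`; projecting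
    -- back from `a 0` gives the earlier repetition `b m = b k`.
    have e₁ := c_eq 1 m k (by rw [add_comm 1 m, add_comm 1 k]; exact hbk)
    have e₂ := b_eq 0 0 _ _ rfl e₁
    rw [zero_add, zero_add] at e₂
    exact absurd (b_inj m k (by omega) (by omega) e₂) (by omega)
  have hn2 : 2 ≤ n := by
    by_contra hlt
    obtain rfl : n = 1 := by omega
    exact T.b_ne 0 hbk.symm
  have : NeZero n := ⟨by omega⟩
  have cn : c n = c 0 := c_eq 0 _ _ (by rwa [zero_add])
  have bper : ∀ m, b (m + n) = b m := fun m => b_eq m m _ _ rfl cn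
  have cper : ∀ m, c (m + n) = c m := fun m => c_eq 0 _ _ (by rw [zero_add, zero_add]; exact bper m)
  have aper : ∀ m, a (m + n) = a m := fun m => a_eq _ _ 0 (bper m)
  obtain ⟨A, hA⟩ := exists_zmod_lift aper
  obtain ⟨B, hB⟩ := exists_zmod_lift bper
  obtain ⟨C, hC⟩ := exists_zmod_lift cper
  have aff : ∀ {F : ZMod n → P} {f : ℕ → P}, (∀ m : ℕ, F m = f m) →
      (∀ i, conj d (f (i + 1)) (f i) (f (i + 2))) → ∀ i, conj d (F (i + 1)) (F i) (F (i + 2)) := by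
    intro F f hF hf i
    obtain ⟨i, rfl⟩ := ZMod.natCast_zmod_surjective i
    have := hf i
    rw [← hF, ← hF, ← hF] at this
    simpa using this
  have inj : ∀ {F : ZMod n → P} {f : ℕ → P}, (∀ m : ℕ, F m = f m) →
      (∀ i j, f i = f j → b i = b j) → F.Injective := by
    intro F f hF hf i j e
    rw [← ZMod.natCast_zmod_val i, ← ZMod.natCast_zmod_val j, hF, hF] at e
    exact ZMod.val_injective n (b_inj _ _ (ZMod.val_lt _) (ZMod.val_lt _) (hf _ _ e))
  have ev : ∀ {F : ZMod n → P} {f : ℕ → P}, (∀ m : ℕ, F m = f m) → F 0 = f 0 ∧ F 1 = f 1 :=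
    fun hF => ⟨by simpa using hF 0, by simpa using hF 1⟩
  refine ⟨hn2, A, B, C, ?_, by rw [(ev hA).1, ha0], by rw [(ev hA).2, ha1], (ev hB).1, (ev hB).2,
    by rw [(ev hC).1, hc0], by rw [(ev hC).2, hc1], aff hA hac, aff hB T.conj_b, aff hC hcc⟩
  have all : ∀ {p : ZMod n → ZMod n → Prop}, (∀ i j : ℕ, p i j) → ∀ i j, p i j := by
    intro p hp i j
    obtain ⟨i, rfl⟩ := ZMod.natCast_zmod_surjective i
    obtain ⟨j, rfl⟩ := ZMod.natCast_zmod_surjective j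
    exact hp i j
  constructor
  · refine all fun i j => ?_
    rw [hA, hA]
    exact S.trans (S.ne₁ T.dac) (S.left _ _) (ha i).2 (ha j).2
  · refine all fun i j => ?_
    rw [hB, hB]; exact T.bb _ _
  · refine all fun i j => ?_
    rw [hC, hC]
    exact S.trans (S.ne₁ (T.dcb 0)) (S.left _ _) (hc i).2 (hc j).2
  · refine all fun i j => ?_
    rw [hA, hB]; exact dab _ _
  · refine all fun i j => ?_
    rw [hA, hC]; exact dac _ _
  · refine all fun i j => ?_
    rw [hB, hC]; exact fun k => dcb _ _ (S.swap₂ k)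
  · exact inj hA fun i j e => b_eq _ _ 0 0 e rfl
  · exact inj hB fun i j e => e
  · refine inj hC fun i j e => ?_
    have := b_eq 0 0 _ _ rfl e
    rwa [zero_add, zero_add] at this
  · refine all fun i j => ?_
    rw [← Nat.cast_add, hA, hB, hC]
    exact S.swap₂ (h i j)

namespace Grid

variable {n : ℕ} {d : P} {A B C : ZMod n → P}

theorem abc_iff (S : HarmonicSpace col conj) (G : Grid col n d A B C) {i j k : ZMod n} :
    col (A i) (B k) (C j) ↔ k = i + j := by
  refine ⟨fun h => G.injB ?_, fun h => h ▸ G.abc i j⟩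
  exact S.meet (a := A i) (b := C j) (c := d) (e := B k)
    (fun k => G.dAC _ _ (S.rot (S.rot k))) (S.ne₃ (G.dAB i k)) (S.swap₂ h) (S.swap₂ (G.abc i j))
    (S.right _ _) (G.dB _ _)

/-- With `A i, B (i + j), C j` fixed, `t` varies over many quadrangles with the same conjugate. That
one point therefore lies on all lines `B (j + t) C (i + j - t)`, the lines whose two indices have
the same sum `i + 2j`. -/
theorem quad_reflect (S : HarmonicSpace col conj) (G : Grid col n d A B C) {i j t : ZMod n}
    (ht : t ≠ i) :
    Quad col (B (i + j)) (A i) (C j) (B (j + t)) d (C (i + j - t)) (A t) := by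
  have hP := S.perm
  have hs := S.self
  have h₁ := G.dBC (i + j) j
  have h₂ : ¬ col (A t) (B (i + j)) (C j) := by
    rw [G.abc_iff S]; exact fun h => ht (add_right_cancel h).symm
  have h₃ := G.dAB t (i + j)
  have h₄ := G.dAC t j
  have h₅ := G.abc i j
  have h₆ := G.dA t i
  have h₇ := G.dB (i + j) (j + t)
  have h₈ : col (A t) (B (j + t)) (C j) := by rw [G.abc_iff S, add_comm]
  have h₉ : col (A t) (B (i + j)) (C (i + j - t)) := by rw [G.abc_iff S]; ring
  have h₁₀ := G.dC j (i + j - t)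
  constructor <;> grind only

theorem exists_reflect (S : HarmonicSpace col conj) (hn : 2 ≤ n) (G : Grid col n d A B C)
    (i j : ZMod n) :
    ∃ x, conj (B (i + j)) (C j) (A i) x ∧ col (B (i + j)) (C j) x ∧
      ∀ t ≠ i, col (B (j + t)) (C (i + j - t)) x := by
  have : Fact (1 < n) := ⟨hn⟩
  obtain ⟨x, hx, hx₁, -, -⟩ := S.exists_conj
    (G.quad_reflect S (i := i) (j := j) (t := i + 1) (by simp))
  refine ⟨x, hx, hx₁, fun t ht => ?_⟩
  obtain ⟨y, hy, -, hy₁, -⟩ := S.exists_conj (G.quad_reflect S (i := i) (j := j) ht)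
  rwa [S.conj_unique hx hy]

/-- The points conjugate for `(i, j)` and `(i - 2, j + 1)` both lie on the distinct lines `B (i + j)
C j` and `B (i + j - 1) C (j + 1)`, so they coincide. Iteration shows that the conjugate depends
only on `i + 2j`, which becomes the index of `A'`. -/
theorem exists_column (S : HarmonicSpace col conj) (hn : 2 ≤ n) (G : Grid col n d A B C) :
    ∃ A' : ZMod n → P, (∀ i j, conj (B (i + j)) (C j) (A i) (A' (i + j + j))) ∧
      ∀ i j, col (B i) (A' (i + j)) (C j) := by
  have : Fact (1 < n) := ⟨hn⟩
  have : NeZero n := ⟨by omega⟩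
  choose X h₁ h₂ h₃ using G.exists_reflect S hn
  have step : ∀ i j, X (i - 1 - 1) (j + 1) = X i j := fun i j => by
    have e₁ := h₃ i j (i - 1) (by simp)
    have e₂ := h₃ (i - 1 - 1) (j + 1) (i - 1) fun h => one_ne_zero (sub_eq_self.1 h.symm)
    have e₃ := h₂ (i - 1 - 1) (j + 1)
    rw [show j + 1 + (i - 1) = i + j by ring, show i - 1 - 1 + (j + 1) - (i - 1) = j by ring] at e₂
    rw [show i - 1 - 1 + (j + 1) = j + (i - 1) by ring] at e₃
    rw [show i + j - (i - 1) = j + 1 by ring] at e₁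
    have hC : ¬ col (C j) (C (j + 1)) (B (i + j)) :=
      S.not_col_of_ne (fun h => by simpa using G.injC h) (G.dC _ _) fun h => G.dBC _ _ (S.swap₂ h)
    exact S.meet (a := B (i + j)) (b := C j) (c := C (j + 1)) (e := B (j + (i - 1)))
      (fun h => hC (S.rot h)) (S.ne₂ (G.dBC _ _)).symm e₂ (h₂ i j) (S.swap e₃) (S.swap e₁)
  have all : ∀ (m : ℕ) k, X (k - m - m) m = X k 0 := by
    intro m
    induction m with
    | zero => intro k; simp
    | succ m ih =>
      intro k
      rw [← ih, ← step (k - m - m) m]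
      push_cast
      congr 1
      ring
  have key : ∀ i j, X i j = X (i + j + j) 0 := fun i j => by
    obtain ⟨m, rfl⟩ := ZMod.natCast_zmod_surjective j
    rw [← all m]
    congr 1
    ring
  refine ⟨fun k => X k 0, fun i j => ?_, fun i j => ?_⟩
  · have := h₁ i j
    rwa [key] at this
  · have := h₂ (i - j) j
    rw [sub_add_cancel, key, sub_add_cancel] at this
    exact S.swap₂ this

/-- Only the alignment of the `A' k` with `d` needs a further quadrangle: the one with vertices `B
k', C 0, B k, C (k - k')` has `d` and `A' k` as diagonal points, so the conjugate `A' k'` of `A k'`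
lies on their line. -/
theorem exists_next (S : HarmonicSpace col conj) (hn : 2 ≤ n) (G : Grid col n d A B C) :
    ∃ A' : ZMod n → P, Grid col n d B A' C ∧ ∀ k, conj (B k) (C 0) (A k) (A' k) := by
  have : Fact (1 < n) := ⟨hn⟩
  obtain ⟨A', h₁, h₂⟩ := G.exists_column S hn
  -- A point `A' k` on the line of the `B`'s would be its intersection with every line `B (k - j) C
  -- j`, so `B (k - j)` would be the same for all `j`. The same argument with `C j` excludes the
  -- line of the `C`'s.
  have hBA : ∀ i k, ¬ col d (B i) (A' k) := by
    intro i k hc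
    have e : ∀ j, A' k = B (k - j) := fun j => by
      have e₁ := h₂ (k - j) j
      rw [sub_add_cancel] at e₁
      exact S.meet (a := B (k - j)) (b := C j) (c := d) (e := B i)
        (fun h => G.dBC _ _ (S.rot (S.rot h))) (S.ne₁ (G.dBC i 0)) (S.swap₂ e₁) (S.left _ _) hc
        (G.dB _ _)
    exact one_ne_zero (sub_eq_self.1 ((sub_zero k).symm.trans (G.injB ((e 0).symm.trans (e 1)))).symm)
  have hAC : ∀ k i, ¬ col d (A' k) (C i) := by
    intro k i hc
    have e : ∀ j, A' k = C j := fun j => by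
      have e₁ := h₂ (k - j) j
      rw [sub_add_cancel] at e₁
      exact S.meet (a := B (k - j)) (b := C j) (c := d) (e := C i)
        (fun h => G.dBC _ _ (S.rot (S.rot h))) (S.ne₃ (G.dBC 0 i)) (S.swap₂ e₁) (S.right _ _)
        (S.swap₂ hc) (G.dC _ _)
    have := G.injC ((e 0).symm.trans (e 1))
    simp at this
  have inj : A'.Injective := by
    intro k k' e
    have e₁ := h₂ k 0
    have e₂ := h₂ k' 0
    rw [add_zero] at e₁ e₂
    rw [← e] at e₂
    refine G.injB (S.meet (a := A' k) (b := C 0) (c := d) (e := B k)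
      (fun h => hAC _ _ (S.rot (S.rot h))) (S.ne₁ (G.dBC k 0)) (S.rot e₁) (S.rot e₂)
      (S.right _ _) (G.dB _ _))
  have hA : ∀ k k', col d (A' k) (A' k') := by
    intro k k'
    by_cases hk : k = k'
    · subst hk; exact S.right _ _
    have Q : Quad col (B k') (A k') (C 0) d (B k) (A' k) (C (k - k')) := by
      have hP := S.perm
      have hs := S.self
      have hC : 0 ≠ k - k' := fun h => hk (sub_eq_zero.1 h.symm)
      have e₁ := G.abc k' 0
      have e₂ := G.abc k' (k - k')
      have e₃ := h₂ k 0
      have e₄ := h₂ k' (k - k')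
      rw [add_zero] at e₁ e₃
      rw [add_sub_cancel] at e₂ e₄
      have q₁ := S.not_col_of_ne (fun h => hk (G.injB h).symm) (G.dB k' k) (G.dBC k' 0)
      have q₂ := S.not_col_of_ne (fun h => hk (G.injB h).symm) (G.dB k' k) (G.dBC k' (k - k'))
      have q₃ := S.not_col_of_ne (fun h => hC (G.injC h)) (G.dC 0 (k - k'))
        (fun h => G.dBC k' 0 (S.swap₂ h))
      have q₄ := S.not_col_of_ne (fun h => hC (G.injC h)) (G.dC 0 (k - k'))
        (fun h => G.dBC k 0 (S.swap₂ h))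
      have e₅ := G.dB k' k
      have e₆ := G.dC 0 (k - k')
      constructor <;> grind only
    obtain ⟨x, hx, -, hx', -⟩ := S.exists_conj Q
    have := h₁ k' 0
    rw [add_zero, add_zero] at this
    rwa [S.conj_unique hx this] at hx'
  refine ⟨A', ⟨G.dB, hA, G.dC, hBA, G.dBC, hAC, G.injB, inj, G.injC, h₂⟩, fun k => ?_⟩
  have := h₁ k 0
  rwa [add_zero, add_zero] at this

end Grid
-- The sequence of columns and the primality of `n`
variable {n : ℕ} {d : P} {A B C : ZMod n → P}

theorem Grid.exists_columns (S : HarmonicSpace col conj) (hn : 2 ≤ n) (G : Grid col n d A B C) :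
    ∃ H : ℕ → ZMod n → P, H 0 = A ∧ H 1 = B ∧ (∀ x, Grid col n d (H x) (H (x + 1)) C) ∧
      ∀ x k, conj (H (x + 1) k) (C 0) (H x k) (H (x + 2) k) := by
  choose F hF hF' using fun p : {p : (ZMod n → P) × (ZMod n → P) // Grid col n d p.1 p.2 C} =>
    p.2.exists_next S hn
  let s : ℕ → {p : (ZMod n → P) × (ZMod n → P) // Grid col n d p.1 p.2 C} :=
    Nat.rec ⟨(A, B), G⟩ fun _ p => ⟨(p.1.2, F p), hF p⟩
  exact ⟨fun x => (s x).1.1, rfl, rfl, fun x => (s x).2, fun x => hF' (s x)⟩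

/-- A sequence of columns, each two consecutive ones forming a grid with `C`. -/
def Columns (col : P → P → P → Prop) (n : ℕ) (d : P) (C : ZMod n → P) (H : ℕ → ZMod n → P) :
    Prop :=
  ∀ x, Grid col n d (H x) (H (x + 1)) C

namespace Columns

variable {H : ℕ → ZMod n → P}

theorem shift (h : Columns col n d C H) (x : ℕ) : Columns col n d C fun y => H (x + y) :=
  fun y => h (x + y)

/-- Each passage to the next column along the line through `C m` raises the index by `m`, by the
grid incidence. -/
theorem col_line (S : HarmonicSpace col conj) (h : Columns col n d C H) (x : ℕ) (m k : ZMod n) :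
    col (C m) (H 0 k) (H x (m * x + k)) := by
  induction x with
  | zero => simpa using S.right _ _
  | succ x ih =>
    have e := (h x).abc (m * x + k) m
    rw [show m * x + k + m = m * (x + 1 : ℕ) + k by push_cast; ring] at e
    exact S.trans (S.ne₂ ((h x).dAC (m * x + k) m)).symm (S.left _ _) (S.swap₂ ih)
      (S.rot (S.rot e))

theorem col_line' (S : HarmonicSpace col conj) (h : Columns col n d C H) (x : ℕ) (m k : ZMod n) :
    col (C m) (H 0 (k - m * x)) (H x k) := by
  simpa using h.col_line S x m (k - m * x)

/-- As `v * u = 0`, the lines from `C 0` and from `C v` to `H u k` both pass through `H 0 k`;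
distinct lines share only one point. -/
theorem eq_zero_column (S : HarmonicSpace col conj) (h : Columns col n d C H) {u : ℕ}
    {v : ZMod n} (hv : v ≠ 0) (hu : v * u = 0) (k : ZMod n) : H u k = H 0 k := by
  have e₁ := h.col_line' S u 0 k
  have e₂ := h.col_line' S u v k
  rw [zero_mul, sub_zero] at e₁
  rw [hu, sub_zero] at e₂
  exact S.meet (a := C 0) (b := H 0 k) (c := C v) (e := H 0 k)
    (fun hh => S.not_col_of_ne (fun h' => hv ((h 0).injC h')) ((h 0).dC v 0)
      (fun h' => (h 0).dAC k v (S.swap₂ h')) (S.rot (S.rot hh)))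
    (S.ne₂ ((h 0).dAC k v)).symm e₁ (S.right _ _) e₂ (S.right _ _)

/-- Were `m * u + k' ≠ k`, the line from `C m` through `H 0 k' = H u k` would contain a second point
of the column `H u` and equal that column's line, which avoids `C m`. So `m * u + k' = k` for all
`m`; compare `m = 0` and `m = 1`. -/
theorem cast_eq_zero (S : HarmonicSpace col conj) (h : Columns col n d C H) {u : ℕ}
    {k k' : ZMod n} (hu : H u k = H 0 k') : (u : ZMod n) = 0 := by
  have key : ∀ m : ZMod n, m * u + k' = k := fun m => by
    by_contra hne
    have e := h.col_line S u m k'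
    rw [← hu] at e
    exact S.not_col_of_ne (fun h' => hne ((h u).injA h')) ((h u).dA _ _) ((h u).dAC _ m)
      (S.swap (S.rot e))
  have e₀ := key 0
  have e₁ := key 1
  rw [zero_mul, zero_add] at e₀
  rw [one_mul, e₀] at e₁
  simpa using e₁

theorem prime (S : HarmonicSpace col conj) (hn : 2 ≤ n) (h : Columns col n d C H) : n.Prime := by
  by_contra hp
  obtain ⟨u, v, hu, hv, huv⟩ := (Nat.not_prime_iff_exists_mul_eq hn).1 hp
  have cast_ne : ∀ w : ℕ, w < n → w ≠ 0 → (w : ZMod n) ≠ 0 := fun w hw hw0 h0 =>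
    hw0 (Nat.eq_zero_of_dvd_of_lt ((ZMod.natCast_eq_zero_iff w n).1 h0) hw)
  have hu0 : u ≠ 0 := by rintro rfl; omega
  have hv0 : v ≠ 0 := by rintro rfl; omega
  refine cast_ne u hu hu0 (h.cast_eq_zero S (h.eq_zero_column S (cast_ne v hv hv0) ?_ 0))
  rw [← Nat.cast_mul, mul_comm, huv, ZMod.natCast_self]

theorem periodic (S : HarmonicSpace col conj) (hn : 2 ≤ n) (h : Columns col n d C H) (x : ℕ) :
    H (x + n) = H x := by
  have : Fact (1 < n) := ⟨hn⟩
  funext k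
  exact (h.shift x).eq_zero_column S one_ne_zero (u := n) (by simp) k

theorem cast_inj (S : HarmonicSpace col conj) (h : Columns col n d C H) {x x' : ℕ}
    {k k' : ZMod n} (e : H x k = H x' k') : (x : ZMod n) = x' := by
  rcases le_total x x' with hx | hx
  · obtain ⟨y, rfl⟩ := Nat.exists_eq_add_of_le hx
    have := (h.shift x).cast_eq_zero S (u := y) (k := k') (k' := k) e.symm
    simp [this]
  · obtain ⟨y, rfl⟩ := Nat.exists_eq_add_of_le hx
    have := (h.shift x').cast_eq_zero S (u := y) (k := k) (k' := k') e
    simp [this]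

end Columns

/-! ### Coordinates in `ZMod n` -/

/-- Points `d`, `C m`, `H x y` that form a coordinatized plane: `d` and the `C m` are on a line,
the `H x y` with fixed `x` are on a line with `d`, and the `H x (m x + k)` are on a line
with `C m`. -/
structure PlaneData (col : P → P → P → Prop) (n : ℕ) (d : P) (C : ZMod n → P)
    (H : ZMod n → ZMod n → P) : Prop where
  dC : ∀ i j, col d (C i) (C j)
  dH : ∀ x i j, col d (H x i) (H x j)
  dHC : ∀ x i j, ¬ col d (H x i) (C j)
  injC : C.Injective
  injH : ∀ {x y x' y'}, H x y = H x' y' → x = x' ∧ y = y'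
  col_line : ∀ m k x, col (C m) (H 0 k) (H x (m * x + k))

theorem Grid.exists_planeData (S : HarmonicSpace col conj) (hn : 2 ≤ n) (G : Grid col n d A B C) :
    n.Prime ∧ ∃ H : ZMod n → ZMod n → P, PlaneData col n d C H ∧ H 0 = A ∧ H 1 = B ∧
      ∀ x k, conj (H (x + 1) k) (C 0) (H x k) (H (x + 2) k) := by
  have : NeZero n := ⟨by omega⟩
  obtain ⟨H, h0, h1, hH : Columns col n d C H, hc⟩ := G.exists_columns S hn
  refine ⟨hH.prime S hn, ?_⟩
  obtain ⟨F, hF⟩ := exists_zmod_lift (hH.periodic S hn)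
  have hF0 : F 0 = H 0 := by simpa using hF 0
  have hF1 : F 1 = H 1 := by simpa using hF 1
  refine ⟨F, ⟨G.dC, fun x i j => ?_, fun x i j => ?_, G.injC, fun {x y x' y'} e => ?_,
    fun m k x => ?_⟩, hF0.trans h0, hF1.trans h1, fun x k => ?_⟩
  · obtain ⟨x, rfl⟩ := ZMod.natCast_zmod_surjective x
    rw [hF]; exact (hH x).dA i j
  · obtain ⟨x, rfl⟩ := ZMod.natCast_zmod_surjective x
    rw [hF]; exact (hH x).dAC i j
  · obtain ⟨x, rfl⟩ := ZMod.natCast_zmod_surjective x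
    obtain ⟨x', rfl⟩ := ZMod.natCast_zmod_surjective x'
    have e' := e
    rw [hF, hF] at e'
    have hx := hH.cast_inj S e'
    rw [← hx, hF] at e
    exact ⟨hx, (hH x).injA e⟩
  · obtain ⟨x, rfl⟩ := ZMod.natCast_zmod_surjective x
    rw [hF, hF0]; exact hH.col_line S x m k
  · obtain ⟨x, rfl⟩ := ZMod.natCast_zmod_surjective x
    have := hc x k
    rw [← hF, ← hF, ← hF] at this
    simpa using this

/-! ### Planes and their closure under conjugation -/

/-- A set of points any two of whose lines meet in it, with at least three points of the set on
each line, and not contained in a line. -/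
structure IsPlane (col : P → P → P → Prop) (X : Set P) : Prop where
  meet : ∀ {p q r s}, p ∈ X → q ∈ X → r ∈ X → s ∈ X → p ≠ q → r ≠ s →
    ∃ u ∈ X, col p q u ∧ col r s u
  third : ∀ {p q}, p ∈ X → q ∈ X → p ≠ q → ∃ s ∈ X, col p q s ∧ s ≠ p ∧ s ≠ q
  triangle : ∃ p ∈ X, ∃ q ∈ X, ∃ r ∈ X, ¬ col p q r

theorem IsPlane.exists_not_col (S : HarmonicSpace col conj) {X : Set P} (hX : IsPlane col X)
    {p q : P} (hpq : p ≠ q) : ∃ r ∈ X, ¬ col p q r := by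
  obtain ⟨u, hu, v, hv, w, hw, h⟩ := hX.triangle
  by_contra! hc
  exact h (S.trans hpq (hc u hu) (hc v hv) (hc w hw))

/-- A plane is closed under harmonic conjugation. -/
theorem IsPlane.conj_mem (S : HarmonicSpace col conj) {X : Set P} (hX : IsPlane col X)
    {y x z : P} (hy : y ∈ X) (hx : x ∈ X) (hz : z ∈ X) (hyx : y ≠ x) (hyz : y ≠ z) (hxz : x ≠ z)
    (h : col y z x) : ∃ x' ∈ X, conj y z x x' := by
  have hP := S.perm
  have hs := S.self
  -- The quadrangle is built inside `X`: `q` off the line `y z`, then `s` a third point on `x q`;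
  -- the diagonal points `o, r` and finally `x'` are meets of lines of `X`.
  obtain ⟨q, hq, hyzq⟩ := hX.exists_not_col S hyz
  have hxq : x ≠ q := by rintro rfl; exact hyzq h
  obtain ⟨s, hs', hxqs, hsx, hsq⟩ := hX.third hx hq hxq
  have hyzs : ¬ col y z s := fun k => hyzq (S.collapse (u := x) (v := s) (e := x) hsx.symm hyz
    hxq.symm h k (S.right _ _) (S.swap hxqs))
  have hxy : ¬ col q s y := fun k => hyzq (S.trans hyx (S.left _ _) (S.swap₂ h)
    (S.trans hsq.symm k (S.rot hxqs) (S.left _ _)))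
  have hxz' : ¬ col q s z := fun k => hyzq (S.swap (S.trans hxz.symm (S.left _ _)
    (S.rot h)
    (S.trans hsq.symm k (S.rot hxqs) (S.left _ _))))
  have hyq := S.ne₃ hyzq
  have hzq := S.ne₂ hyzq
  have hys := S.ne₃ hyzs
  have hzs := S.ne₂ hyzs
  obtain ⟨o, ho, hyqo, hzso⟩ := hX.meet hy hq hz hs' hyq hzs
  obtain ⟨r, hr, hysr, hzqr⟩ := hX.meet hy hs' hz hq hys hzq
  have Q : Quad col y x z o q r s := by
    constructor <;> grind only
  have hor : o ≠ r := by
    rintro rfl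
    have hoy : o = y := S.meet (a := y) (b := q) (c := s) (e := y) (fun k => hxy (S.rot k))
      hys.symm hyqo (S.left _ _) (S.swap hysr) (S.right _ _)
    subst hoy
    exact hyzs (S.swap (S.swap₂ hzso))
  obtain ⟨x', hx', h₁, h₂, h₃⟩ := S.exists_conj Q
  obtain ⟨u, hu, hu₁, hu₂⟩ := hX.meet hy hz ho hr hyz hor
  exact ⟨x', h₃ u hu₁ hu₂ ▸ hu, hx'⟩

/-! ### The coordinatized points form a plane -/

namespace PlaneData

variable {n : ℕ} {d : P} {C : ZMod n → P} {H : ZMod n → ZMod n → P}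

/-- The points of a coordinatized plane. -/
def point (d : P) (C : ZMod n → P) (H : ZMod n → ZMod n → P) :
    Option (ZMod n ⊕ ZMod n × ZMod n) → P
  | none => d
  | some (Sum.inl m) => C m
  | some (Sum.inr p) => H p.1 p.2

theorem ne_C (S : HarmonicSpace col conj) (D : PlaneData col n d C H) (m : ZMod n) : d ≠ C m :=
  S.ne₃ (D.dHC 0 0 m)

theorem ne_H (S : HarmonicSpace col conj) (D : PlaneData col n d C H) (x y : ZMod n) : d ≠ H x y :=
  S.ne₁ (D.dHC x y 0)

theorem C_ne_H (S : HarmonicSpace col conj) (D : PlaneData col n d C H) (m x y : ZMod n) :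
    C m ≠ H x y := (S.ne₂ (D.dHC x y m)).symm

theorem point_injective (S : HarmonicSpace col conj) (D : PlaneData col n d C H) :
    (point d C H).Injective := by
  rintro (_ | m | ⟨x, y⟩) (_ | m' | ⟨x', y'⟩) h
  · rfl
  · exact absurd h (D.ne_C S _)
  · exact absurd h (D.ne_H S _ _)
  · exact absurd h.symm (D.ne_C S _)
  · rw [D.injC h]
  · exact absurd h (D.C_ne_H S _ _ _)
  · exact absurd h.symm (D.ne_H S _ _)
  · exact absurd h.symm (D.C_ne_H S _ _ _)
  · obtain ⟨rfl, rfl⟩ := D.injH h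
    rfl

theorem ncard_range (S : HarmonicSpace col conj) (hn : n.Prime) (D : PlaneData col n d C H) :
    (Set.range (point d C H)).ncard = n ^ 2 + n + 1 := by
  have : NeZero n := ⟨hn.ne_zero⟩
  rw [← Set.image_univ, Set.ncard_image_of_injective _ (D.point_injective S), Set.ncard_univ,
    Nat.card_eq_fintype_card]
  simp [ZMod.card]
  ring

theorem col_line' (D : PlaneData col n d C H) (m x y : ZMod n) :
    col (C m) (H 0 (y - m * x)) (H x y) := by
  simpa using D.col_line m (y - m * x) x

/-- A line is the line at infinity, a vertical line, or has a slope and an intercept. The slope of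
two points in different columns exists because `ZMod n` is a field. -/
theorem line_cases (S : HarmonicSpace col conj) (hn : n.Prime) (D : PlaneData col n d C H)
    {p q : P} (hp : p ∈ Set.range (point d C H)) (hq : q ∈ Set.range (point d C H))
    (hpq : p ≠ q) : (∀ u, col p q u ↔ col d (C 0) u) ∨ (∃ x, ∀ u, col p q u ↔ col d (H x 0) u) ∨
      ∃ m k, ∀ u, col p q u ↔ col (C m) (H 0 k) u := by
  have : Fact n.Prime := ⟨hn⟩
  have h₁ : ∀ {p q}, p ≠ q → col d (C 0) p → col d (C 0) q → ∀ u, col p q u ↔ col d (C 0) u :=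
    fun hpq hp hq => S.line_eq (D.ne_C S 0) hpq hp hq
  have h₂ : ∀ {p q} x, p ≠ q → col d (H x 0) p → col d (H x 0) q →
      ∀ u, col p q u ↔ col d (H x 0) u :=
    fun x hpq hp hq => S.line_eq (D.ne_H S x 0) hpq hp hq
  have h₃ : ∀ {p q} m k, p ≠ q → col (C m) (H 0 k) p → col (C m) (H 0 k) q →
      ∀ u, col p q u ↔ col (C m) (H 0 k) u :=
    fun m k hpq hp hq => S.line_eq (D.C_ne_H S m 0 k) hpq hp hq
  obtain ⟨_ | m | ⟨x, y⟩, rfl⟩ := hp <;> obtain ⟨_ | m' | ⟨x', y'⟩, rfl⟩ := hq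
  · exact absurd rfl hpq
  · exact .inl (h₁ hpq (S.left _ _) (D.dC _ _))
  · exact .inr (.inl ⟨x', h₂ _ hpq (S.left _ _) (D.dH _ _ _)⟩)
  · exact .inl (h₁ hpq (D.dC _ _) (S.left _ _))
  · exact .inl (h₁ hpq (D.dC _ _) (D.dC _ _))
  · exact .inr (.inr ⟨m, _, h₃ _ _ hpq (S.left _ _) (D.col_line' m x' y')⟩)
  · exact .inr (.inl ⟨x, h₂ _ hpq (D.dH _ _ _) (S.left _ _)⟩)
  · exact .inr (.inr ⟨m', _, h₃ _ _ hpq (D.col_line' m' x y) (S.left _ _)⟩)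
  · by_cases hx : x = x'
    · subst hx
      exact .inr (.inl ⟨x, h₂ _ hpq (D.dH _ _ _) (D.dH _ _ _)⟩)
    · have hx' : x' - x ≠ 0 := sub_ne_zero.2 (Ne.symm hx)
      refine .inr (.inr ⟨(y' - y) / (x' - x), _, h₃ _ _ hpq (D.col_line' _ x y) ?_⟩)
      have := D.col_line' ((y' - y) / (x' - x)) x' y'
      rwa [show y' - (y' - y) / (x' - x) * x' = y - (y' - y) / (x' - x) * x by
        field_simp; ring] at this

theorem isPlane (S : HarmonicSpace col conj) (hn : n.Prime) (D : PlaneData col n d C H) :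
    IsPlane col (Set.range (point d C H)) where
  meet := by
    intro p q r s hp hq hr hs hpq hrs
    have : Fact n.Prime := ⟨hn⟩
    have md : d ∈ Set.range (point d C H) := ⟨none, rfl⟩
    have mC : ∀ m, C m ∈ Set.range (point d C H) := fun m => ⟨some (.inl m), rfl⟩
    have mH : ∀ x y, H x y ∈ Set.range (point d C H) := fun x y => ⟨some (.inr (x, y)), rfl⟩
    rcases D.line_cases S hn hp hq hpq with h | ⟨x, h⟩ | ⟨m, k, h⟩ <;>
    rcases D.line_cases S hn hr hs hrs with h' | ⟨x', h'⟩ | ⟨m', k', h'⟩ <;>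
    simp only [h, h']
    · exact ⟨d, md, S.left _ _, S.left _ _⟩
    · exact ⟨d, md, S.left _ _, S.left _ _⟩
    · exact ⟨C m', mC _, D.dC _ _, S.left _ _⟩
    · exact ⟨d, md, S.left _ _, S.left _ _⟩
    · exact ⟨d, md, S.left _ _, S.left _ _⟩
    · exact ⟨H x (m' * x + k'), mH _ _, D.dH _ _ _, D.col_line _ _ _⟩
    · exact ⟨C m, mC _, S.left _ _, D.dC _ _⟩
    · exact ⟨H x' (m * x' + k), mH _ _, D.col_line _ _ _, D.dH _ _ _⟩
    · by_cases hm : m = m'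
      · subst hm
        exact ⟨C m, mC _, S.left _ _, S.left _ _⟩
      -- The abscissa solves `m x + k = m' x + k'`.
      · have hm' : m - m' ≠ 0 := sub_ne_zero.2 hm
        refine ⟨H ((k' - k) / (m - m')) (m * ((k' - k) / (m - m')) + k), mH _ _,
          D.col_line _ _ _, ?_⟩
        have := D.col_line m' k' ((k' - k) / (m - m'))
        convert this using 2
        field_simp
        ring
  third := by
    intro p q hp hq hpq
    have : Fact n.Prime := ⟨hn⟩
    have mC : ∀ m, C m ∈ Set.range (point d C H) := fun m => ⟨some (.inl m), rfl⟩
    have mH : ∀ x y, H x y ∈ Set.range (point d C H) := fun x y => ⟨some (.inr (x, y)), rfl⟩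
    -- Among three distinct points of a line, one differs from both `p` and `q`.
    have pick : ∀ {u v w : P}, u ∈ Set.range (point d C H) → v ∈ Set.range (point d C H) →
        w ∈ Set.range (point d C H) → u ≠ v → u ≠ w → v ≠ w → (∀ t, col p q t ↔ col u v t) →
        col u v w → ∃ s ∈ Set.range (point d C H), col p q s ∧ s ≠ p ∧ s ≠ q := by
      intro u v w hu hv hw huv huw hvw h hc
      have h₁ := (h u).2 (S.left _ _)
      have h₂ := (h v).2 (S.right _ _)
      have h₃ := (h w).2 hc
      by_cases hup : u = p
      · by_cases hvq : v = q
        · exact ⟨w, hw, h₃, hup ▸ huw.symm, hvq ▸ hvw.symm⟩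
        · exact ⟨v, hv, h₂, hup ▸ huv.symm, hvq⟩
      · by_cases huq : u = q
        · by_cases hvp : v = p
          · exact ⟨w, hw, h₃, hvp ▸ hvw.symm, huq ▸ huw.symm⟩
          · exact ⟨v, hv, h₂, hvp, huq ▸ huv.symm⟩
        · exact ⟨u, hu, h₁, hup, huq⟩
    rcases D.line_cases S hn hp hq hpq with h | ⟨x, h⟩ | ⟨m, k, h⟩
    · exact pick ⟨none, rfl⟩ (mC 0) (mC 1) (D.ne_C S 0) (D.ne_C S 1)
        (fun h => zero_ne_one (D.injC h)) h (D.dC _ _)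
    · exact pick ⟨none, rfl⟩ (mH x 0) (mH x 1) (D.ne_H S _ _) (D.ne_H S _ _)
        (fun h => zero_ne_one (D.injH h).2) h (D.dH _ _ _)
    · exact pick (mC m) (mH 0 k) (mH 1 _) (D.C_ne_H S _ _ _) (D.C_ne_H S _ _ _)
        (fun h => zero_ne_one (D.injH h).1) h (D.col_line m k 1)
  triangle := ⟨d, ⟨none, rfl⟩, H 0 0, ⟨some (.inr (0, 0)), rfl⟩, C 0, ⟨some (.inl 0), rfl⟩,
    D.dHC _ _ _⟩

end PlaneData
end HarmonicSpace
end HarmonicMatroid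

/-! ### Non-collinear triples of a quadrangle -/

namespace HarmonicMatroid

theorem LinearSpace.not_col_of_vertex {P : Type*} {col : P → P → P → Prop} (S : LinearSpace col)
    {p u w u' w' : P} (h : ¬ col p u w) (hu : col p u u') (hw : col p w w') (hpu : p ≠ u')
    (hpw : p ≠ w') : ¬ col p u' w ∧ ¬ col p u w' ∧ ¬ col p u' w' := by
  have h₁ : ¬ col p u' w := fun k => h ((S.line_eq (S.ne₁ h) hpu (S.left _ _) hu w).1 k)
  have key : ∀ {x}, ¬ col p x w → ¬ col p x w' := fun hx k =>
    hx (S.swap₂ ((S.line_eq (S.ne₃ hx) hpw (S.left _ _) hw _).1 (S.swap₂ k)))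
  exact ⟨h₁, key h, key h₁⟩

set_option maxRecDepth 100000 in
/-- The non-collinear triples of a configuration `Quad`. -/
theorem Quad.not_col {P : Type*} {col : P → P → P → Prop} (S : LinearSpace col)
    {y x z o q r s : P} (Q : Quad col y x z o q r s) (I : Finset (Fin 7)) (hI : I.card = 3)
    (hIl : I ∉ fanoLines) : ∃ i j k, I = {i, j, k} ∧
      ¬ col (![y, x, z, o, q, r, s] i) (![y, x, z, o, q, r, s] j) (![y, x, z, o, q, r, s] k) := by
  have hmem : I ∈ ([{0, 1, 3}, {0, 1, 4}, {0, 1, 5}, {0, 1, 6}, {0, 2, 3}, {0, 2, 4}, {0, 2, 5}, {0, 2, 6}, {0, 3, 5}, {0, 3, 6}, {0, 4, 5}, {0, 4, 6}, {1, 2, 3}, {1, 2, 4}, {1, 2, 5}, {1, 2, 6}, {1, 3, 4}, {1, 3, 6}, {1, 4, 5}, {1, 5, 6}, {2, 3, 4}, {2, 3, 5}, {2, 4, 6}, {2, 5, 6}, {3, 4, 5}, {3, 4, 6}, {3, 5, 6}, {4, 5, 6}] : List (Finset (Fin 7))) := by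
    revert I; decide
  obtain ⟨yzq, yzs, yqs, zqs, yzx, qsx, yqo, zso, ysr, zqr⟩ := Q
  have hp := S.perm
  -- Each of the four vertices with each pair of sides through it: on each side the other vertex may
  -- be replaced by the diagonal point.
  have t1 := S.not_col_of_vertex (p := y) (u := z) (w := q) (u' := x) (w' := o)
    (by grind only) (by grind only) (by grind only) (by grind only) (by grind only)
  have t2 := S.not_col_of_vertex (p := y) (u := z) (w := s) (u' := x) (w' := r)
    (by grind only) (by grind only) (by grind only) (by grind only) (by grind only)
  have t3 := S.not_col_of_vertex (p := y) (u := q) (w := s) (u' := o) (w' := r)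
    (by grind only) (by grind only) (by grind only) (by grind only) (by grind only)
  have t4 := S.not_col_of_vertex (p := z) (u := y) (w := q) (u' := x) (w' := r)
    (by grind only) (by grind only) (by grind only) (by grind only) (by grind only)
  have t5 := S.not_col_of_vertex (p := z) (u := y) (w := s) (u' := x) (w' := o)
    (by grind only) (by grind only) (by grind only) (by grind only) (by grind only)
  have t6 := S.not_col_of_vertex (p := z) (u := q) (w := s) (u' := r) (w' := o)
    (by grind only) (by grind only) (by grind only) (by grind only) (by grind only)
  have t7 := S.not_col_of_vertex (p := q) (u := y) (w := z) (u' := o) (w' := r)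
    (by grind only) (by grind only) (by grind only) (by grind only) (by grind only)
  have t8 := S.not_col_of_vertex (p := q) (u := y) (w := s) (u' := o) (w' := x)
    (by grind only) (by grind only) (by grind only) (by grind only) (by grind only)
  have t9 := S.not_col_of_vertex (p := q) (u := z) (w := s) (u' := r) (w' := x)
    (by grind only) (by grind only) (by grind only) (by grind only) (by grind only)
  have t10 := S.not_col_of_vertex (p := s) (u := y) (w := z) (u' := r) (w' := o)
    (by grind only) (by grind only) (by grind only) (by grind only) (by grind only)
  have t11 := S.not_col_of_vertex (p := s) (u := y) (w := q) (u' := r) (w' := x)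
    (by grind only) (by grind only) (by grind only) (by grind only) (by grind only)
  have t12 := S.not_col_of_vertex (p := s) (u := z) (w := q) (u' := o) (w' := x)
    (by grind only) (by grind only) (by grind only) (by grind only) (by grind only)
  simp only [List.mem_cons, List.not_mem_nil, or_false] at hmem
  rcases hmem with rfl | rfl | rfl | rfl | rfl | rfl | rfl | rfl | rfl | rfl | rfl | rfl | rfl | rfl | rfl | rfl | rfl | rfl | rfl | rfl | rfl | rfl | rfl | rfl | rfl | rfl | rfl | rfl <;>
  exact ⟨_, _, _, rfl, by simp; grind only⟩

end HarmonicMatroid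

/-! ### Collinearity as rank, and labelled configurations -/

namespace HarmonicMatroid

variable {α : Type*} {M : Matroid α}

/-- Collinearity in a matroid. -/
def MCol (M : Matroid α) (x y z : α) : Prop := M.eRk {x, y, z} ≤ 2

theorem MCol.swap {x y z : α} (h : MCol M x y z) : MCol M y x z := by
  rwa [MCol, Set.insert_comm] at h

theorem MCol.rot {x y z : α} (h : MCol M x y z) : MCol M y z x := by
  rw [MCol, Set.insert_comm] at h
  rwa [MCol, Set.pair_comm]

theorem MCol.perm (x y z : α) (h : MCol M x y z) :
    MCol M y x z ∧ MCol M x z y ∧ MCol M z y x ∧ MCol M y z x ∧ MCol M z x y :=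
  ⟨h.swap, h.rot.rot.swap, h.rot.swap, h.rot, h.rot.rot⟩

theorem encard_pair_le_two (x y : α) : ({x, y} : Set α).encard ≤ 2 := by
  refine (Set.encard_insert_le _ _).trans ?_
  rw [Set.encard_singleton]
  exact le_of_eq one_add_one_eq_two

theorem eRk_pair_le (M : Matroid α) (x y : α) : M.eRk {x, y} ≤ 2 :=
  (M.eRk_le_encard _).trans (encard_pair_le_two x y)

theorem mCol_self (M : Matroid α) (x y : α) : MCol M x x y := by
  rw [MCol, Set.insert_idem]
  exact eRk_pair_le M x y

theorem mem_closure_pair_iff {x y w : α} (h : M.Indep {x, y}) (hxy : x ≠ y) (hw : w ∈ M.E) :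
    w ∈ M.closure {x, y} ↔ MCol M x y w := by
  have h2 : M.eRk {x, y} = 2 := by rw [h.eRk_eq_encard, Set.encard_pair hxy]
  have hset : ({x, y, w} : Set α) = insert w {x, y} := by
    ext; simp; tauto
  constructor
  · intro hwc
    rw [MCol, hset, ← M.eRk_closure_eq, Matroid.closure_insert_eq_of_mem_closure hwc,
      M.eRk_closure_eq, h2]
  · intro hc
    by_contra hwc
    have := M.eRk_insert_eq_add_one ⟨hw, hwc⟩
    rw [MCol, hset, this, h2] at hc
    exact absurd hc (by decide)

theorem MCol.trans {x y u v w : α} (h : M.Indep {x, y}) (hxy : x ≠ y) (hu : u ∈ M.E)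
    (hv : v ∈ M.E) (hw : w ∈ M.E) (h₁ : MCol M x y u) (h₂ : MCol M x y v) (h₃ : MCol M x y w) :
    MCol M u v w := by
  rw [← mem_closure_pair_iff h hxy ‹_›] at h₁ h₂ h₃
  have hs : ({u, v, w} : Set α) ⊆ M.closure {x, y} := by
    rintro t (rfl | rfl | rfl) <;> assumption
  exact (M.eRk_mono hs).trans ((M.eRk_closure_eq _).trans_le (eRk_pair_le M x y))

theorem indep_of_not_mCol {x y z : α} (h : ¬ MCol M x y z) : M.Indep {x, y, z} ∧
    ({x, y, z} : Set α).encard = 3 := by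
  have h₁ : 3 ≤ M.eRk {x, y, z} := by
    have := not_le.1 h
    exact Order.add_one_le_of_lt this
  have h₂ : ({x, y, z} : Set α).encard ≤ 3 := by
    refine (Set.encard_insert_le _ _).trans ?_
    exact (add_le_add_left (encard_pair_le_two y z) 1).trans (le_of_eq two_add_one_eq_three)
  have h₃ := M.eRk_le_encard {x, y, z}
  have h₄ : M.eRk {x, y, z} = ({x, y, z} : Set α).encard := le_antisymm h₃ (h₂.trans h₁)
  exact ⟨(Matroid.indep_iff_eRk_eq_encard_of_finite (Set.toFinite _)).2 h₄,
    le_antisymm h₂ (h₁.trans h₃)⟩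

/-! ### Labelled restrictions -/

set_option maxRecDepth 100000 in
theorem card_of_mem_fanoLines : ∀ I ∈ fanoLines, I.card = 3 := by decide

theorem nonFanoLines_subset : nonFanoLines ⊆ fanoLines := Finset.subset_insert _ _

set_option maxRecDepth 100000 in
-- Puts every pair of labels in an independent triple, so distinctness and independence of pairs
-- follow from conditions on triples alone.
theorem exists_triple_notMem_fanoLines : ∀ i j : Fin 7, i ≠ j →
    ∃ k, ({i, j, k} : Finset (Fin 7)).card = 3 ∧ {i, j, k} ∉ fanoLines := by decide

theorem RestrictsTo.eRk_le_two_iff {v : Fin 7 → α} {lines : Finset (Finset (Fin 7))}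
    (h : RestrictsTo M v lines) (I : Finset (Fin 7)) (hI : I.card = 3) :
    M.eRk (v '' (I : Set (Fin 7))) ≤ 2 ↔ I ∈ lines := by
  have hc : (v '' (I : Set (Fin 7))).encard = 3 := by
    rw [h.1.encard_image, Set.encard_coe_eq_coe_finsetCard, hI]; rfl
  have hi := h.2.2 I
  rw [Matroid.indep_iff_eRk_eq_encard_of_finite (Set.toFinite _), hc] at hi
  have hle := M.eRk_le_encard (v '' (I : Set (Fin 7)))
  rw [hc] at hle
  constructor
  · intro h2
    by_contra hl
    rw [hi.2 ⟨hI.le, hl⟩] at h2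
    exact absurd h2 (by decide)
  · intro hl
    by_contra h2
    have : 3 ≤ M.eRk (v '' (I : Set (Fin 7))) := Order.add_one_le_of_lt (not_le.1 h2)
    exact (hi.1 (le_antisymm hle this)).2 hl

theorem restrictsTo_of_eRk {v : Fin 7 → α} {lines : Finset (Finset (Fin 7))}
    (hl : lines ⊆ fanoLines) (hE : ∀ i, v i ∈ M.E) (hr : M.eRk (Set.range v) ≤ 3)
    (h : ∀ I : Finset (Fin 7), I.card = 3 → (M.eRk (v '' (I : Set (Fin 7))) ≤ 2 ↔ I ∈ lines)) :
    RestrictsTo M v lines := by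
  have himg : ∀ i j k, v '' (({i, j, k} : Finset (Fin 7)) : Set (Fin 7)) = {v i, v j, v k} := by
    intro i j k
    simp [Set.image_insert_eq]
  have hT : ∀ i j k, ({i, j, k} : Finset (Fin 7)).card = 3 → {i, j, k} ∉ lines →
      M.Indep {v i, v j, v k} ∧ ({v i, v j, v k} : Set α).encard = 3 := by
    intro i j k hc hn
    refine indep_of_not_mCol fun hcol => hn ?_
    rw [← h _ hc, himg]
    exact hcol
  have hinj : v.Injective := by
    intro i j hij
    by_contra hne
    obtain ⟨k, hc, hk⟩ := exists_triple_notMem_fanoLines i j hne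
    have := (hT i j k hc fun hh => hk (hl hh)).2
    rw [hij, Set.insert_idem] at this
    have h2 := encard_pair_le_two (v j) (v k)
    rw [this] at h2
    exact absurd h2 (by decide)
  refine ⟨hinj, hE, fun I => ⟨fun hI => ?_, fun ⟨hc, hn⟩ => ?_⟩⟩
  · have he := hI.eRk_eq_encard
    rw [hinj.encard_image, Set.encard_coe_eq_coe_finsetCard] at he
    have hle := (M.eRk_mono (Set.image_subset_range v (I : Set (Fin 7)))).trans hr
    rw [he] at hle
    refine ⟨by exact_mod_cast hle, fun hIl => ?_⟩
    have hc := card_of_mem_fanoLines I (hl hIl)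
    have := (h I hc).2 hIl
    rw [he, hc] at this
    exact absurd this (by decide)
  · have key : ∃ J : Finset (Fin 7), I ⊆ J ∧ J.card = 3 ∧ J ∉ lines := by
      rcases hc.eq_or_lt with hc | hc
      · exact ⟨I, subset_rfl, hc, hn⟩
      · obtain ⟨T, hIT, hT⟩ := Finset.exists_superset_card_eq (n := 2) (by omega : I.card ≤ 2)
          (by simp)
        obtain ⟨i, j, hij, rfl⟩ := Finset.card_eq_two.1 hT
        obtain ⟨k, hc, hk⟩ := exists_triple_notMem_fanoLines i j hij
        refine ⟨{i, j, k}, hIT.trans ?_, hc, fun hh => hk (hl hh)⟩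
        intro t; simp; tauto
    obtain ⟨J, hIJ, hJ, hJl⟩ := key
    obtain ⟨i, j, k, -, -, -, rfl⟩ := Finset.card_eq_three.1 hJ
    have := (hT i j k hJ hJl).1
    rw [← himg] at this
    exact this.subset (Set.image_mono (by exact_mod_cast hIJ))

theorem HP.injective {y x z o q r s : α} (h : HP M y x z o q r s) :
    Function.Injective ![y, x, z, o, q, r, s] := by
  rcases h with h | h <;> exact h.1

theorem HP.mem_ground {y x z o q r s : α} (h : HP M y x z o q r s) (i : Fin 7) :
    ![y, x, z, o, q, r, s] i ∈ M.E := by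
  rcases h with h | h <;> exact h.2.1 i

theorem HP.indep_pair {y x z o q r s : α} (h : HP M y x z o q r s) (i j : Fin 7) :
    M.Indep {![y, x, z, o, q, r, s] i, ![y, x, z, o, q, r, s] j} := by
  have key : ∀ lines ⊆ fanoLines, RestrictsTo M ![y, x, z, o, q, r, s] lines →
      M.Indep {![y, x, z, o, q, r, s] i, ![y, x, z, o, q, r, s] j} := by
    intro lines hl h
    have := (h.2.2 {i, j}).2 ⟨(Finset.card_le_two).trans (by norm_num), fun hh => by
      have h3 := card_of_mem_fanoLines _ (hl hh)
      have h2 := Finset.card_le_two (a := i) (b := j)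
      omega⟩
    simpa [Set.image_insert_eq] using this
  rcases h with h | h
  · exact key _ subset_rfl h
  · exact key _ nonFanoLines_subset h

theorem HP.quad {y x z o q r s : α} (h : HP M y x z o q r s) : Quad (MCol M) y x z o q r s := by
  have key : ∀ i j k : Fin 7, ({i, j, k} : Finset (Fin 7)).card = 3 →
      ({i, j, k} ∉ fanoLines → ¬ MCol M (![y, x, z, o, q, r, s] i) (![y, x, z, o, q, r, s] j)
        (![y, x, z, o, q, r, s] k)) ∧
      ({i, j, k} ∈ nonFanoLines → MCol M (![y, x, z, o, q, r, s] i) (![y, x, z, o, q, r, s] j)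
        (![y, x, z, o, q, r, s] k)) := by
    intro i j k hc
    have himg : (![y, x, z, o, q, r, s]) '' (({i, j, k} : Finset (Fin 7)) : Set (Fin 7)) =
        {![y, x, z, o, q, r, s] i, ![y, x, z, o, q, r, s] j, ![y, x, z, o, q, r, s] k} := by
      simp [Set.image_insert_eq]
    rw [MCol, ← himg]
    rcases h with h | h <;> rw [h.eRk_le_two_iff _ hc]
    · exact ⟨id, fun hh => nonFanoLines_subset hh⟩
    · exact ⟨fun hh h' => hh (nonFanoLines_subset h'), id⟩
  exact ⟨(key 0 2 4 (by decide)).1 (by decide), (key 0 2 6 (by decide)).1 (by decide),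
    (key 0 4 6 (by decide)).1 (by decide), (key 2 4 6 (by decide)).1 (by decide),
    (key 0 2 1 (by decide)).2 (by decide), (key 4 6 1 (by decide)).2 (by decide),
    (key 0 4 3 (by decide)).2 (by decide), (key 2 6 3 (by decide)).2 (by decide),
    (key 0 6 5 (by decide)).2 (by decide), (key 2 4 5 (by decide)).2 (by decide)⟩

end HarmonicMatroid

/-! ### Quadrangles give `HP` configurations -/

namespace HarmonicMatroid

variable {α : Type*} {M : Matroid α}

/-- A set of pairwise non-parallel elements of a matroid is a linear space. -/
theorem linearSpace_subtype {S : Set α} (hE : S ⊆ M.E)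
    (hS : ∀ x ∈ S, ∀ y ∈ S, x ≠ y → M.Indep {x, y}) :
    LinearSpace fun x y z : S => MCol M x y z where
  swap := MCol.swap
  rot := MCol.rot
  self x y := mCol_self M x y
  trans := fun {x y u v w} hxy => MCol.trans (hS x x.2 y y.2 fun h => hxy (Subtype.ext h))
    (fun h => hxy (Subtype.ext h)) (hE u.2) (hE v.2) (hE w.2)

theorem Quad.hp {S : Set α} (hE : S ⊆ M.E) (hS : ∀ x ∈ S, ∀ y ∈ S, x ≠ y → M.Indep {x, y})
    {y x z o q r s : S} (Q : Quad (fun x y z : S => MCol M x y z) y x z o q r s) :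
    HP M y x z o q r s := by
  have L := linearSpace_subtype hE hS
  have hv : ∀ i, ![(y : α), x, z, o, q, r, s] i = (![y, x, z, o, q, r, s] i : S) := by
    intro i; fin_cases i <;> rfl
  have hvE : ∀ i, ![(y : α), x, z, o, q, r, s] i ∈ M.E := fun i => by
    rw [hv]; exact hE (Subtype.property _)
  have cl : ∀ {a b w : S} {X : Set α}, a ≠ b → MCol M a b w → (a : α) ∈ M.closure X →
      (b : α) ∈ M.closure X → (w : α) ∈ M.closure X := by
    intro a b w X hab h ha hb
    have hab' : (a : α) ≠ b := fun h => hab (Subtype.ext h)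
    have := (mem_closure_pair_iff (hS a a.2 b b.2 hab') hab' (hE w.2)).2 h
    refine Matroid.closure_subset_closure_of_subset_closure ?_ this
    rintro t (rfl | rfl) <;> assumption
  -- The vertices `y, z, q` span: `x, o, r` lie on their sides, and `s` lies on `q x`.
  have hr : M.eRk (Set.range ![(y : α), x, z, o, q, r, s]) ≤ 3 := by
    have hsub : ({(y : α), (z : α), (q : α)} : Set α) ⊆ M.E := by
      rintro t (rfl | rfl | rfl) <;> exact hE (Subtype.property _)
    have my := M.mem_closure_of_mem (X := {(y : α), (z : α), (q : α)}) (e := y) (by simp) hsub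
    have mz := M.mem_closure_of_mem (X := {(y : α), (z : α), (q : α)}) (e := z) (by simp) hsub
    have mq := M.mem_closure_of_mem (X := {(y : α), (z : α), (q : α)}) (e := q) (by simp) hsub
    have hqx : q ≠ x := by
      rintro rfl
      exact Q.yzq Q.yzx
    have mx := cl (L.ne₁ Q.yzq) Q.yzx my mz
    have mo := cl (L.ne₃ Q.yzq) Q.yqo my mq
    have mr := cl (L.ne₂ Q.yzq) Q.zqr mz mq
    have ms := cl hqx (L.swap₂ Q.qsx) mq mx
    have hsubset : Set.range ![(y : α), x, z, o, q, r, s] ⊆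
        M.closure {(y : α), (z : α), (q : α)} := by
      rintro _ ⟨i, rfl⟩
      fin_cases i <;> assumption
    refine (M.eRk_mono hsubset).trans ?_
    rw [M.eRk_closure_eq]
    refine (M.eRk_le_encard _).trans ((Set.encard_insert_le _ _).trans ?_)
    exact (add_le_add_left (encard_pair_le_two _ _) 1).trans (le_of_eq two_add_one_eq_three)
  have himg : ∀ i j k, ![(y : α), x, z, o, q, r, s] '' (({i, j, k} : Finset (Fin 7)) : Set (Fin 7)) =
      {![(y : α), x, z, o, q, r, s] i, ![(y : α), x, z, o, q, r, s] j,
        ![(y : α), x, z, o, q, r, s] k} := by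
    intro i j k
    simp [Set.image_insert_eq]
  have hnot : ∀ I : Finset (Fin 7), I.card = 3 → I ∉ fanoLines →
      ¬ M.eRk (![(y : α), x, z, o, q, r, s] '' (I : Set (Fin 7))) ≤ 2 := by
    intro I hc hI
    obtain ⟨i, j, k, rfl, h⟩ := Q.not_col L I hc hI
    rw [himg, hv, hv, hv]
    exact h
  have hcol : ∀ I ∈ nonFanoLines,
      M.eRk (![(y : α), x, z, o, q, r, s] '' (I : Set (Fin 7))) ≤ 2 := by
    intro I hI
    simp only [nonFanoLines, Finset.mem_insert, Finset.mem_singleton] at hI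
    rcases hI with rfl | rfl | rfl | rfl | rfl | rfl <;> rw [himg]
    · exact L.swap₂ Q.yzx
    · exact L.swap₂ Q.yqo
    · exact L.swap₂ Q.ysr
    · exact L.rot (L.rot Q.qsx)
    · exact Q.zqr
    · exact L.swap₂ Q.zso
  by_cases hx : MCol M x o r
  · refine .inl (restrictsTo_of_eRk subset_rfl hvE hr fun I hI => ⟨fun h => ?_, fun h => ?_⟩)
    · by_contra hn
      exact hnot I hI hn h
    · rcases Finset.mem_insert.1 h with rfl | h
      · rw [himg]; exact hx
      · exact hcol I h
  · refine .inr (restrictsTo_of_eRk nonFanoLines_subset hvE hr fun I hI => ⟨fun h => ?_, hcol I⟩)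
    by_contra hn
    by_cases hI' : I = {1, 3, 5}
    · subst hI'
      rw [himg] at h
      exact hx h
    · exact hnot I hI (by simp [fanoLines, hn, hI']) h

/-! ### Projective planes from rank-2 flats -/

section Plane

variable {X : Set α}

theorem exists_line (hE : X ⊆ M.E) (hS : ∀ x ∈ X, ∀ y ∈ X, x ≠ y → M.Indep {x, y}) {p q : X}
    (hpq : p ≠ q) : ∃ l : Line M X, ∀ u : X, u ∈ l ↔ MCol M p q u := by
  have hpq' : (p : α) ≠ q := fun h => hpq (Subtype.ext h)
  have hi := hS p p.2 q q.2 hpq'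
  have hsub : ({(p : α), (q : α)} : Set α) ⊆ X := by
    rintro t (rfl | rfl) <;> exact Subtype.property _
  refine ⟨⟨(M.restrict X).closure {(p : α), (q : α)}, Matroid.isFlat_closure _, ?_⟩, fun u => ?_⟩
  · rw [Matroid.eRk_closure_eq, Matroid.restrict_eRk_eq _ hsub, hi.eRk_eq_encard,
      Set.encard_pair hpq']
  · rw [← mem_closure_pair_iff hi hpq' (hE u.2)]
    change (u : α) ∈ (M.restrict X).closure {(p : α), (q : α)} ↔ _
    rw [Matroid.restrict_closure_eq _ hsub hE]
    simp

theorem line_spec (hE : X ⊆ M.E) (l : Line M X) :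
    ∃ p q : X, p ≠ q ∧ ∀ u : X, u ∈ l ↔ MCol M p q u := by
  obtain ⟨F, hF, hr⟩ := l
  obtain ⟨I, hI⟩ := (M.restrict X).exists_isBasis F hF.subset_ground
  rw [← hI.encard_eq_eRk] at hr
  obtain ⟨p, q, hpq, rfl⟩ := Set.encard_eq_two.1 hr
  have hFX : F ⊆ X := hF.subset_ground
  have hsub := hI.subset.trans hFX
  have hind := (Matroid.restrict_indep_iff.1 hI.indep).1
  refine ⟨⟨p, hsub (by simp)⟩, ⟨q, hsub (by simp)⟩, fun h => hpq (congrArg Subtype.val h),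
    fun u => ?_⟩
  change (u : α) ∈ F ↔ MCol M p q u
  rw [← mem_closure_pair_iff hind hpq (hE u.2), ← hF.closure, ← hI.closure_eq_closure,
    Matroid.restrict_closure_eq _ hsub hE]
  simp

theorem line_ext {l l' : Line M X} (h : ∀ u : X, u ∈ l ↔ u ∈ l') : l = l' := by
  obtain ⟨F, hF, hr⟩ := l
  obtain ⟨F', hF', hr'⟩ := l'
  refine Subtype.ext (Set.ext fun u => ⟨fun hu => ?_, fun hu => ?_⟩)
  · exact (h ⟨u, hF.subset_ground hu⟩).1 hu
  · exact (h ⟨u, hF'.subset_ground hu⟩).2 hu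

open HarmonicSpace in
-- Joins come from rank-2 closures and meets from `IsPlane`. The order is then determined by the
-- number of points, since `n² + n + 1` is strictly increasing in `n`.
theorem isProjectivePlaneOfOrder (hE : X ⊆ M.E)
    (hS : ∀ x ∈ X, ∀ y ∈ X, x ≠ y → M.Indep {x, y}) (hX : IsPlane (MCol M) X) {n : ℕ}
    (hn : X.ncard = n ^ 2 + n + 1) : IsProjectivePlaneOfOrder M X n := by
  have L := linearSpace_subtype hE hS
  have : Finite X := Set.finite_of_ncard_pos (by omega)
  have : Finite (Line M X) := by
    refine Finite.of_injective (fun l : Line M X => {u : X | u ∈ l}) fun l l' h => line_ext fun u => ?_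
    exact Set.ext_iff.1 h u
  have hne : ∀ {p q : X}, p ≠ q → (p : α) ≠ q := fun h h' => h (Subtype.ext h')
  have hmeet : ∀ l l' : Line M X, ∃ u : X, u ∈ l ∧ u ∈ l' := by
    intro l l'
    obtain ⟨p, q, hpq, h⟩ := line_spec hE l
    obtain ⟨p', q', hpq', h'⟩ := line_spec hE l'
    obtain ⟨u, hu, hu₁, hu₂⟩ := hX.meet p.2 q.2 p'.2 q'.2 (hne hpq) (hne hpq')
    exact ⟨⟨u, hu⟩, (h _).2 hu₁, (h' _).2 hu₂⟩
  have hjoin : ∀ {p q : X}, p ≠ q → ∃ l : Line M X, p ∈ l ∧ q ∈ l := by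
    intro p q hpq
    obtain ⟨l, hl⟩ := exists_line hE hS hpq
    exact ⟨l, (hl _).2 (L.left _ _), (hl _).2 (L.right _ _)⟩
  obtain ⟨a, ha, b, hb, c, hc, habc⟩ := hX.triangle
  lift a to X using ha
  lift b to X using hb
  lift c to X using hc
  have hab : a ≠ b := L.ne₁ habc
  have hbc : b ≠ c := L.ne₂ habc
  have hac : a ≠ c := L.ne₃ habc
  -- Third points `u` on `b c` and `w` on `a c` supply the lines `a u` and `b w`, which with `b c`
  -- give the nondegenerate configuration.
  obtain ⟨u, hu, hbcu, hub, huc⟩ := hX.third b.2 c.2 (hne hbc)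
  obtain ⟨w, hw, hacw, hwa, hwc⟩ := hX.third a.2 c.2 (hne hac)
  lift u to X using hu
  lift w to X using hw
  have hub : u ≠ b := fun h => hub (congrArg _ h)
  have huc : u ≠ c := fun h => huc (congrArg _ h)
  have hwa : w ≠ a := fun h => hwa (congrArg _ h)
  have hwc : w ≠ c := fun h => hwc (congrArg _ h)
  have hp := MCol.perm (M := M)
  have hawb : ¬ MCol M a w b :=
    L.not_col_of_ne (d := c) hwa.symm (by grind only) (by grind only)
  have hcwb : ¬ MCol M c w b :=
    L.not_col_of_ne (d := a) hwc.symm (by grind only) (by grind only)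
  have hbua : ¬ MCol M b u a :=
    L.not_col_of_ne (d := c) hub.symm (by grind only) (by grind only)
  have hcua : ¬ MCol M c u a :=
    L.not_col_of_ne (d := b) huc.symm (by grind only) (by grind only)
  obtain ⟨l₁, h₁⟩ := exists_line hE hS (p := a) (q := u) (L.ne₂ hbua).symm
  obtain ⟨l₂, h₂⟩ := exists_line hE hS hbc
  obtain ⟨l₃, h₃⟩ := exists_line hE hS (p := b) (q := w) (L.ne₂ hcwb).symm
  obtain ⟨lab, h_ab⟩ := exists_line hE hS hab
  obtain ⟨lac, h_ac⟩ := exists_line hE hS hac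
  let plane : Configuration.ProjectivePlane X (Line M X) :=
    { exists_point := fun l => by
        obtain ⟨p, q, hpq, h⟩ := line_spec hE l
        by_contra! hall
        exact habc (L.trans hpq ((h a).1 (hall a)) ((h b).1 (hall b)) ((h c).1 (hall c)))
      exists_line := fun p => by
        by_contra! hall
        have hpa : p = a := L.meet (e := a) habc hac.symm ((h_ab p).1 (hall _)) (L.left _ _)
          (L.swap ((h_ac p).1 (hall _))) (L.right _ _)
        subst hpa
        exact habc (L.rot (L.rot ((h₂ p).1 (hall _))))
      eq_or_eq := fun {p q l l'} hp hq hp' hq' => by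
        by_contra! hne'
        refine hne'.2 (line_ext fun t => ?_)
        obtain ⟨x, y, hxy, h⟩ := line_spec hE l
        obtain ⟨x', y', hxy', h'⟩ := line_spec hE l'
        rw [h, h', ← L.line_eq hxy hne'.1 ((h p).1 hp) ((h q).1 hq),
          ← L.line_eq hxy' hne'.1 ((h' p).1 hp') ((h' q).1 hq')]
      mkPoint := fun {l l'} _ => (hmeet l l').choose
      mkPoint_ax := fun {l l'} _ => (hmeet l l').choose_spec
      mkLine := fun h => (hjoin h).choose
      mkLine_ax := fun h => (hjoin h).choose_spec
      exists_config := ⟨a, b, c, l₁, l₂, l₃,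
        fun h => by grind only,
        fun h => by grind only,
        fun h => by grind only,
        (h₂ b).2 (L.left _ _), (h₃ b).2 (L.left _ _),
        fun h => by grind only,
        (h₂ c).2 (L.right _ _),
        fun h => by grind only⟩ }
  refine ⟨hE, plane, ?_⟩
  have : Fintype X := Fintype.ofFinite X
  have hcard := Configuration.ProjectivePlane.card_points X (Line M X)
  rw [← Nat.card_eq_fintype_card, Nat.card_coe_set_eq, hn] at hcard
  rcases lt_trichotomy (Configuration.ProjectivePlane.order X (Line M X)) n with h | h | h
  · nlinarith
  · exact h
  · nlinarith

end Plane
end HarmonicMatroid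

/-! ### Loops, parallel elements and harmonic closure -/

namespace HarmonicMatroid

variable {α : Type*} {M : Matroid α}

/-- A nonloop without parallel elements, in a matroid without loops. -/
def IsIsolated (M : Matroid α) (e : α) : Prop := M.IsNonloop e ∧ ∀ f ∈ M.closure {e}, f = e

theorem HarmonicConj.mem_ground {y z x x' : α} (h : HarmonicConj M y z x x') : x' ∈ M.E := by
  obtain ⟨o, q, r, s, -, h⟩ := h
  have : x' ∈ M.closure {y, z} ∩ M.closure {o, r} := h ▸ rfl
  exact Matroid.mem_ground_of_mem_closure this.1

/-- An element of the closure of `{x'}` lies in both closures whose intersection is `{x'}`. -/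
theorem HarmonicConj.isIsolated {y z x x' : α} (h : HarmonicConj M y z x x')
    (hx : M.IsNonloop x') : IsIsolated M x' := by
  refine ⟨hx, fun f hf => ?_⟩
  obtain ⟨o, q, r, s, -, h⟩ := h
  have hx' : x' ∈ M.closure {y, z} ∩ M.closure {o, r} := h ▸ rfl
  have : f ∈ M.closure {y, z} ∩ M.closure {o, r} :=
    ⟨Matroid.closure_subset_closure_of_subset_closure (Set.singleton_subset_iff.2 hx'.1) hf,
      Matroid.closure_subset_closure_of_subset_closure (Set.singleton_subset_iff.2 hx'.2) hf⟩
  rw [h] at this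
  exact this

/-- A loop lies in every closure, in particular in that of `{e}`. -/
theorem IsIsolated.loopless {e : α} (h : IsIsolated M e) : M.Loopless := by
  rw [Matroid.loopless_iff_forall_not_isLoop]
  intro f _ hl
  have := h.2 f (hl.mem_closure _)
  subst this
  exact hl.not_isNonloop h.1

theorem IsIsolated.indep_pair {e f : α} (h : IsIsolated M e) (hf : M.IsNonloop f) (hne : f ≠ e) :
    M.Indep {f, e} := by
  rw [(Matroid.indep_singleton.2 h.1).insert_indep_iff_of_notMem (by simpa using hne)]
  exact ⟨hf.mem_ground, fun hc => hne (h.2 f hc)⟩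

/-- The isolated elements and the elements of a configuration `HP` are pairwise non-parallel. -/
theorem HP.indep_pair_of_mem {y x z o q r s : α} (h : HP M y x z o q r s) :
    ∀ e ∈ {e | IsIsolated M e} ∪ Set.range ![y, x, z, o, q, r, s],
    ∀ f ∈ {e | IsIsolated M e} ∪ Set.range ![y, x, z, o, q, r, s], e ≠ f → M.Indep {e, f} := by
  have hn : ∀ i, M.IsNonloop (![y, x, z, o, q, r, s] i) := fun i =>
    (h.indep_pair i i).isNonloop_of_mem (by simp)
  rintro e (he | ⟨i, rfl⟩) f (hf | ⟨j, rfl⟩) hne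
  · exact IsIsolated.indep_pair hf he.1 hne
  · rw [Set.pair_comm]
    exact IsIsolated.indep_pair he (hn j) hne.symm
  · exact IsIsolated.indep_pair hf (hn i) hne
  · exact h.indep_pair i j

/-- A set of pairwise non-parallel elements of a loopless harmonic matroid that contains the
isolated elements is a harmonic linear space. -/
theorem IsHarmonic.harmonicSpace (hM : IsHarmonic M) (hl : M.Loopless) {S : Set α} (hE : S ⊆ M.E)
    (hS : ∀ x ∈ S, ∀ y ∈ S, x ≠ y → M.Indep {x, y}) (hi : ∀ e, IsIsolated M e → e ∈ S) :
    HarmonicSpace (fun x y z : S => MCol M x y z) (fun y z x x' : S => HarmonicConj M y z x x') :=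
  { linearSpace_subtype hE hS with
    exists_conj := by
      intro y x z o q r s Q
      have hp := Q.hp hE hS
      obtain ⟨x', hx'⟩ := hM.exists_conj _ _ _ _ _ _ _ hp
      have hc : HarmonicConj M y z x x' := ⟨o, q, r, s, hp, hx'⟩
      have hxS := hi x' (hc.isIsolated (Matroid.isNonloop_of_loopless hc.mem_ground))
      have hyz : (y : α) ≠ z := fun h => absurd (hp.injective (a₁ := 0) (a₂ := 2) h) (by decide)
      have hor : (o : α) ≠ r := fun h => absurd (hp.injective (a₁ := 3) (a₂ := 5) h) (by decide)
      have key : ∀ w : S, (MCol M y z w ∧ MCol M o r w) ↔ (w : α) = x' := by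
        intro w
        rw [← mem_closure_pair_iff (hS _ y.2 _ z.2 hyz) hyz (hE w.2),
          ← mem_closure_pair_iff (hS _ o.2 _ r.2 hor) hor (hE w.2), ← Set.mem_inter_iff, hx',
          Set.mem_singleton_iff]
      have h₁ := (key ⟨x', hxS⟩).2 rfl
      exact ⟨⟨x', hxS⟩, hc, h₁.1, h₁.2, fun w hw hw' => Subtype.ext ((key w).1 ⟨hw, hw'⟩)⟩
    conj_unique := fun h h' => Subtype.ext (hM.conj_unique _ _ _ _ _ h h') }

/-! ### Harmonic closure -/

theorem harmonicStep_subset {S X : Set α} (hS : S ⊆ X)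
    (hX : ∀ a ∈ X, ∀ b ∈ X, ∀ c ∈ X, ∀ x, HarmonicConj M a c b x → x ∈ X) :
    harmonicStep M S ⊆ X := by
  rintro x (hx | ⟨-, a, ha, b, hb, c, hc, h⟩)
  · exact hS hx
  · exact hX a (hS ha) b (hS hb) c (hS hc) x h

theorem harmonicClosure_subset {S X : Set α} (hS : S ⊆ X)
    (hX : ∀ a ∈ X, ∀ b ∈ X, ∀ c ∈ X, ∀ x, HarmonicConj M a c b x → x ∈ X) :
    harmonicClosure M S ⊆ X := by
  refine Set.iUnion_subset fun k => ?_
  induction k with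
  | zero => exact hS
  | succ k ih =>
    rw [Function.iterate_succ_apply']
    exact harmonicStep_subset ih hX

theorem iterate_harmonicStep_mono (S : Set α) : Monotone fun k => (harmonicStep M)^[k] S :=
  monotone_nat_of_le_succ fun k => by
    simp only [Function.iterate_succ_apply']
    exact Set.subset_union_left

theorem subset_harmonicClosure (S : Set α) : S ⊆ harmonicClosure M S :=
  Set.subset_iUnion (fun k => (harmonicStep M)^[k] S) 0

theorem HarmonicConj.mem_harmonicClosure {S : Set α} {a b c x : α} (h : HarmonicConj M a c b x)
    (ha : a ∈ harmonicClosure M S) (hb : b ∈ harmonicClosure M S)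
    (hc : c ∈ harmonicClosure M S) : x ∈ harmonicClosure M S := by
  obtain ⟨i, hi⟩ := Set.mem_iUnion.1 ha
  obtain ⟨j, hj⟩ := Set.mem_iUnion.1 hb
  obtain ⟨k, hk⟩ := Set.mem_iUnion.1 hc
  have m := iterate_harmonicStep_mono (M := M) S
  refine Set.mem_iUnion.2 ⟨max i (max j k) + 1, ?_⟩
  rw [Function.iterate_succ_apply']
  exact Or.inr ⟨h.mem_ground, a, m (le_max_left _ _) hi,
    b, m ((le_max_left _ _).trans (le_max_right _ _)) hj,
    c, m ((le_max_right _ _).trans (le_max_right _ _)) hk, h⟩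

theorem forall_zmod_of_step {n : ℕ} [NeZero n] {p : ZMod n → Prop} (h0 : p 0) (h1 : p 1)
    (h : ∀ i, p i → p (i + 1) → p (i + 2)) (i : ZMod n) : p i := by
  obtain ⟨m, rfl⟩ := ZMod.natCast_zmod_surjective i
  have : p (m : ZMod n) ∧ p ((m : ZMod n) + 1) := by
    induction m with
    | zero => exact ⟨by simpa using h0, by simpa using h1⟩
    | succ m ih =>
      refine ⟨by simpa using ih.2, ?_⟩
      have := h _ ih.1 ih.2
      rwa [← one_add_one_eq_two, ← add_assoc, ← Nat.cast_succ] at this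
  exact this.1

end HarmonicMatroid

/-! ### The proposition -/

open HarmonicMatroid HarmonicSpace in
theorem mainTheorem4 {α : Type*} (M : Matroid α) (hM : HarmonicMatroid.IsHarmonic M)
    (d : α) (b : ℕ → α) (n : ℕ) (hb : HarmonicMatroid.IsModularSequence M d b n) :
    n.Prime ∧
      ∃ c₁ ∈ M.E, ∃ c₀ ∈ M.E, ∃ a₁ ∈ M.E, ∃ a₀ ∈ M.E,
        HarmonicMatroid.IsProjectivePlaneOfOrder M
          (HarmonicMatroid.harmonicClosure M {d, b 0, b 1, c₁, c₀, a₁, a₀}) n := by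
  obtain ⟨hseq, hn⟩ := hb
  have hHP : ∀ i, ∃ o q r s, HP M d (b i) (b (i + 1)) o q r s := fun i => by
    obtain ⟨o, q, r, s, h, -⟩ := hseq i
    exact ⟨o, q, r, s, h⟩
  obtain ⟨c₁, c₀, a₁, a₀, h0⟩ := hHP 0
  have hnl : ∀ i, M.IsNonloop (b i) := fun i => by
    obtain ⟨o, q, r, s, h⟩ := hHP i
    exact (h.indep_pair 1 1).isNonloop_of_mem (by simp)
  -- From index 2 on, each term is a harmonic conjugate, and it is no loop because it occurs in a
  -- later configuration.
  have hiso : ∀ i, IsIsolated M (b (i + 2)) := fun i => (hseq i).isIsolated (hnl _)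
  -- The seven starting points may have parallel elements in `M`; `S` contains these chosen
  -- representatives and all isolated elements, hence all conjugates that arise.
  let S : Set α := {e | IsIsolated M e} ∪ Set.range ![d, b 0, b 1, c₁, c₀, a₁, a₀]
  have hS : ∀ e ∈ S, ∀ f ∈ S, e ≠ f → M.Indep {e, f} := h0.indep_pair_of_mem
  have hE : S ⊆ M.E := by
    rintro e (he | ⟨i, rfl⟩)
    · exact he.1.mem_ground
    · exact h0.mem_ground i
  have H := hM.harmonicSpace (hiso 0).loopless hE hS fun e he => Or.inl he
  have hbS : ∀ i, b i ∈ S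
    | 0 => Or.inr ⟨1, rfl⟩
    | 1 => Or.inr ⟨2, rfl⟩
    | i + 2 => Or.inl (hiso i)
  obtain ⟨D, hD⟩ : ∃ D : S, (D : α) = d := ⟨⟨d, Or.inr ⟨0, rfl⟩⟩, rfl⟩
  obtain ⟨C₁, hC₁⟩ : ∃ C₁ : S, (C₁ : α) = c₁ := ⟨⟨c₁, Or.inr ⟨3, rfl⟩⟩, rfl⟩
  obtain ⟨C₀, hC₀⟩ : ∃ C₀ : S, (C₀ : α) = c₀ := ⟨⟨c₀, Or.inr ⟨4, rfl⟩⟩, rfl⟩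
  obtain ⟨A₁, hA₁⟩ : ∃ A₁ : S, (A₁ : α) = a₁ := ⟨⟨a₁, Or.inr ⟨5, rfl⟩⟩, rfl⟩
  obtain ⟨A₀, hA₀⟩ : ∃ A₀ : S, (A₀ : α) = a₀ := ⟨⟨a₀, Or.inr ⟨6, rfl⟩⟩, rfl⟩
  obtain ⟨B, hB⟩ : ∃ B : ℕ → S, ∀ i, (B i : α) = b i := ⟨fun i => ⟨b i, hbS i⟩, fun i => rfl⟩
  have hp := MCol.perm (M := M)
  have hDB : ∀ i, D ≠ B i := fun i h => by
    obtain ⟨o, q, r, s, h'⟩ := hHP i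
    refine absurd (h'.injective (a₁ := 0) (a₂ := 1) ?_) (by decide)
    change d = b i
    rw [← hD, ← hB, h]
  have hBB : ∀ i, B i ≠ B (i + 1) := fun i h => by
    obtain ⟨o, q, r, s, h'⟩ := hHP i
    refine absurd (h'.injective (a₁ := 1) (a₂ := 2) ?_) (by decide)
    change b i = b (i + 1)
    rw [← hB, ← hB, h]
  have hline : ∀ i, MCol M D (B i) (B (i + 1)) := fun i => by
    obtain ⟨o, q, r, s, h⟩ := hHP i
    rw [hD, hB, hB]
    exact (hp _ _ _ h.quad.yzx).2.1
  have hline1 : ∀ i, MCol M D (B 1) (B i) := fun i => by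
    induction i with
    | zero => exact (hp _ _ _ (hline 0)).2.1
    | succ i ih => exact (H.line_eq (hDB 1) (hDB i) (H.left _ _) ih _).1 (hline i)
  have Q := h0.quad
  rw [zero_add, ← hD, ← hC₀, ← hC₁, ← hA₀, ← hA₁, ← hB, ← hB] at Q
  have hoff : ∀ {x : S}, ¬ MCol M D (B 1) x → ∀ i, ¬ MCol M D x (B i) := fun {x} hx i h =>
    hx ((H.line_eq (hDB 1) (hDB i) (H.left _ _) (hline1 i) x).1 (hp _ _ _ h).2.1)
  have hDC : D ≠ C₁ := by
    rintro rfl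
    exact Q.yzs (hp _ _ _ Q.zso).2.2.2.2
  have hDA : D ≠ A₁ := by
    rintro rfl
    exact Q.yzq (hp _ _ _ Q.zqr).2.2.2.2
  have T : Start (fun x y z : S => MCol M x y z) (fun y z x x' : S => HarmonicConj M y z x x')
      D B A₀ A₁ C₀ C₁ :=
    { dab := hoff Q.yzs
      dcb := hoff Q.yzq
      dac := fun h => Q.yqs (hp _ _ _ h).2.1
      bb := fun i j => H.trans (hDB 1) (H.left _ _) (hline1 i) (hline1 j)
      b_ne := hBB
      da := Q.ysr
      dc := Q.yqo
      a_ne := hDA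
      c_ne := hDC
      h₀₀ := (hp _ _ _ Q.qsx).1
      h₀₁ := (hp _ _ _ Q.zso).2.2.2.1
      h₁₀ := (hp _ _ _ Q.zqr).2.2.1
      conj_b := fun i => by rw [hD, hB, hB, hB]; exact hseq i }
  have hn' : IsLeast {m : ℕ | B m = D ∨ ∃ k < m, B m = B k} n := by
    simpa only [Subtype.ext_iff, hB, hD] using hn
  obtain ⟨hn2, A, B', C, G, hA0, hA1, hB0, hB1, hC0, hC1, hA, hB', hC⟩ := T.exists_zmod_grid H hn'
  have : NeZero n := ⟨by omega⟩
  obtain ⟨hprime, F, hF, hF0, hF1, hFc⟩ := G.exists_planeData H hn2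
  have hplane := hF.isPlane H hprime
  have hcl : harmonicClosure M {d, b 0, b 1, c₁, c₀, a₁, a₀} =
      (Subtype.val : S → α) '' Set.range (PlaneData.point D C F) := by
    have mem : ∀ p, ((PlaneData.point D C F p : S) : α) ∈
        (Subtype.val : S → α) '' Set.range (PlaneData.point D C F) := fun p => ⟨_, ⟨p, rfl⟩, rfl⟩
    apply subset_antisymm
    · apply harmonicClosure_subset
      · rw [← hD, ← hB 0, ← hB 1, ← hC₀, ← hC₁, ← hA₀, ← hA₁, ← hB0, ← hB1, ← hC0, ← hC1, ← hA0,
          ← hA1, ← hF0, ← hF1]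
        rintro _ (rfl | rfl | rfl | rfl | rfl | rfl | rfl)
        · exact mem none
        · exact mem (some (.inr (1, 0)))
        · exact mem (some (.inr (1, 1)))
        · exact mem (some (.inl 1))
        · exact mem (some (.inl 0))
        · exact mem (some (.inr (0, 1)))
        · exact mem (some (.inr (0, 0)))
      · rintro _ ⟨y, hy, rfl⟩ _ ⟨x, hx, rfl⟩ _ ⟨z, hz, rfl⟩ x' hx'
        obtain ⟨o, q, r, s, h, -⟩ := id hx'
        have ne : ∀ i j, i ≠ j → ![(y : α), x, z, o, q, r, s] i ≠ ![(y : α), x, z, o, q, r, s] j :=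
          fun i j hij h' => hij (h.injective h')
        -- The plane contains some conjugate of `x`; uniqueness in `M` makes it `x'`.
        obtain ⟨x'', hx'', hc⟩ := hplane.conj_mem H hy hx hz
          (fun h => ne 0 1 (by decide) (congrArg Subtype.val h))
          (fun h => ne 0 2 (by decide) (congrArg Subtype.val h))
          (fun h => ne 1 2 (by decide) (congrArg Subtype.val h)) h.quad.yzx
        exact ⟨x'', hx'', hM.conj_unique _ _ _ _ _ hc hx'⟩
    -- Conjugation with `d` generates the sequences `A`, `B'`, `C` from two terms each; conjugation
    -- with `C 0` then generates all columns from `A` and `B'`.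
    · have sub := subset_harmonicClosure (M := M) ({d, b 0, b 1, c₁, c₀, a₁, a₀} : Set α)
      have mD : (D : α) ∈ harmonicClosure M {d, b 0, b 1, c₁, c₀, a₁, a₀} :=
        sub (by simp [hD])
      have mA : ∀ i, (A i : α) ∈ harmonicClosure M {d, b 0, b 1, c₁, c₀, a₁, a₀} :=
        forall_zmod_of_step (sub (by simp [hA0, hA₀])) (sub (by simp [hA1, hA₁]))
          fun i h₁ h₂ => (hA i).mem_harmonicClosure mD h₁ h₂
      have mB : ∀ i, (B' i : α) ∈ harmonicClosure M {d, b 0, b 1, c₁, c₀, a₁, a₀} :=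
        forall_zmod_of_step (sub (by simp [hB0, hB])) (sub (by simp [hB1, hB]))
          fun i h₁ h₂ => (hB' i).mem_harmonicClosure mD h₁ h₂
      have mC : ∀ i, (C i : α) ∈ harmonicClosure M {d, b 0, b 1, c₁, c₀, a₁, a₀} :=
        forall_zmod_of_step (sub (by simp [hC0, hC₀])) (sub (by simp [hC1, hC₁]))
          fun i h₁ h₂ => (hC i).mem_harmonicClosure mD h₁ h₂
      have mF : ∀ x k, (F x k : α) ∈ harmonicClosure M {d, b 0, b 1, c₁, c₀, a₁, a₀} :=
        fun x k => forall_zmod_of_step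
          (p := fun x => (F x k : α) ∈ harmonicClosure M {d, b 0, b 1, c₁, c₀, a₁, a₀})
          (by rw [hF0]; exact mA k) (by rw [hF1]; exact mB k)
          (fun i h₁ h₂ => (hFc i k).mem_harmonicClosure h₂ h₁ (mC 0)) x
      rintro _ ⟨_, ⟨_ | m | ⟨x, y⟩, rfl⟩, rfl⟩
      · exact mD
      · exact mC m
      · exact mF x y
  refine ⟨hprime, c₁, h0.mem_ground 3, c₀, h0.mem_ground 4, a₁, h0.mem_ground 5, a₀,
    h0.mem_ground 6, ?_⟩
  rw [hcl]
  have hsub : (Subtype.val : S → α) '' Set.range (PlaneData.point D C F) ⊆ S := by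
    rintro _ ⟨x, -, rfl⟩
    exact x.2
  refine isProjectivePlaneOfOrder (hsub.trans hE) (fun x hx y hy => hS x (hsub hx) y (hsub hy))
    ?_ ((Set.ncard_image_of_injective _ Subtype.val_injective).trans (hF.ncard_range H hprime))
  constructor
  · rintro _ _ _ _ ⟨p, hp, rfl⟩ ⟨q, hq, rfl⟩ ⟨r, hr, rfl⟩ ⟨s, hs, rfl⟩ hpq hrs
    obtain ⟨u, hu, h⟩ := hplane.meet hp hq hr hs (fun h => hpq (congrArg _ h))
      (fun h => hrs (congrArg _ h))
    exact ⟨u, ⟨u, hu, rfl⟩, h⟩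
  · rintro _ _ ⟨p, hp, rfl⟩ ⟨q, hq, rfl⟩ hpq
    obtain ⟨u, hu, h, h₁, h₂⟩ := hplane.third hp hq (fun h => hpq (congrArg _ h))
    exact ⟨u, ⟨u, hu, rfl⟩, h, fun h => h₁ (Subtype.ext h), fun h => h₂ (Subtype.ext h)⟩
  · obtain ⟨p, hp, q, hq, r, hr, h⟩ := hplane.triangle
    exact ⟨p, ⟨p, hp, rfl⟩, q, ⟨q, hq, rfl⟩, r, ⟨r, hr, rfl⟩, h⟩
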